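/- Let \(n\ge 1\) and \(m\) be coprime integers and \(c=m/n\). Let \(\mathfrak h\) be the \((n-1)\)-dimensional reflection representation of \(S_n\), let \(\mathbf H_c\) be the rational Cherednik algebra over \(\mathbb C\) generated by \(x\in\mathfrak h^*\), \(y\in\mathfrak h\) and \(S_n\), with \([x,x']=[y,y']=0\), \(\sigma x\sigma^{-1}=\sigma(x)\), \(\sigma y\sigma^{-1}=\sigma(y)\) and \([y,x]=\langle y,x\rangle-c\sum_{s}\langle y,\alpha_s\rangle\langle\alpha_s^\vee,x\rangle s\) (sum over transpositions \(s=(ij)\), with \(\alpha_s=x_i-x_j\), \(\alpha_s^\vee=y_i-y_j\)), and let \(L=L_{m/n}\) be its finite-dimensional irreducible representation. Let \(\mathcal G_i\subset\mathbf H_c\) be the span of products of at most \(i\) elements of \(\mathfrak h\cup\mathfrak h^*\) and arbitrarily many elements of \(S_n\). Write \(\tilde x_i=x_i-\frac1n\sum_jx_j\), \(\tilde y_i=y_i-\frac1n\sum_jy_j\), \(\mathbf h=\frac12\sum_i(\tilde x_i\tilde y_i+\tilde y_i\tilde x_i)\), \(\mathbf x^2=\sum_i\tilde x_i^2\), \(\mathbf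 y^2=\sum_i\tilde y_i^2\). Let \(\Phi\) be the algebra endomorphism \(x_i\mapsto y_i\), \(y_i\mapsto-x_i\), \(\sigma\mapsto\sigma\) of \(\mathbf H_c\) (that is, \(\tilde x_i\mapsto\tilde y_i\), \(\tilde y_i\mapsto-\tilde x_i\)), and also the operator \(\exp(\mathbf x^2/2)\exp(\mathbf y^2/2)\exp(\mathbf x^2/2)\) on \(L\). Let \(\mathcal F\) be any increasing \(\mathbb Z\)-indexed filtration of \(L\) by subspaces with \(\mathcal G_i\mathcal F_j\subset\mathcal F_{i+j}\) and \(\mathbf h\mathcal F_j\subset\mathcal F_j\), and put \(H_{m/n}=H^{\mathcal F}_{m/n}=\operatorname{Hom}_{S_n}(\Lambda^*\mathfrak h,\operatorname{gr}^{\mathcal F}L)\). It is triply graded by \(a=(n-1)(m-1)+2k\) on \(\operatorname{Hom}_{S_n}(\Lambda^k\mathfrak h,-)\), by \(q=\) twice the \(\mathbf h\)-eigenvalue, and by the filtration degree \(f\) (the index \(j\) of \(\operatorname{gr}_j\)). For \(N\in\mathbb Z\) let \(\alpha_N:\mathfrak h\to\mathbf H_c\) be the linear map that sends \(\tilde y_i\)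 to \(\tilde x_i^N-\frac1n\sum_j\tilde x_j^N\) if \(N>0\), to \(\tilde x_i\tilde y_i-\frac1n\sum_j\tilde x_j\tilde y_j\) if \(N=0\), and let \(\alpha_{N}=\Phi\circ\alpha_{-N}\) if \(N<0\). Put \(|N|'=|N|\) for \(N\neq0\) and \(|0|'=2\). For \(\varphi\in\operatorname{Hom}_{S_n}(\Lambda^*\mathfrak h,L)\) let \(\partial_N\varphi(w)=\sum_i\alpha_N(\tilde y_i)\,\varphi(\tilde y_i\wedge w)\) be its contraction with \(\alpha_N\). Then every \(\alpha_N\) is \(S_n\)-equivariant (for conjugation on \(\mathbf H_c\)) with image in \(\mathcal G_{|N|'}\), and for every \(N\) there is a unique linear map \(d_N:H_{m/n}\to H_{m/n}\) induced by \(\partial_N\), i.e. such that whenever \(\varphi\) is equivariant with values in \(\mathcal F_j\), \(\partial_N\varphi\) has values in \(\mathcal F_{j+|N|'}\) and \(d_N\) carries the class of \(\varphi\) in degree \(j\) to the class of \(\partial_N\varphi\) in degree \(j+|N|'\). These maps satisfy: 1. \(d_N^2=0\) and \(d_Md_N=-d_Nd_M\) for all \(M,N\in\mathbb Z\). 2.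 \(d_N\) shifts \((a,q,f)\) by \((-2,\,2N,\,|N|')\). (For the grading \(t=\frac12(a+q+(n-1)(m-1))-f\) this is a shift of \((a,q,t)\) by \((-2,2N,-1)\) if \(N>0\), by \((-2,0,-3)\) if \(N=0\), and by \((-2,2N,2N-1)\) if \(N<0\), the degrees predicted by Dunfield, Gukov and Rasmussen.) 3. The operator \(\Phi\) on \(L\) is bijective and \(\Phi(hp)=\Phi(h)\Phi(p)\) for \(h\in\mathbf H_c\), \(p\in L\). If moreover \(\mathcal F\) is preserved by \(\mathbf x^2\) and \(\mathbf y^2\) (hence by the \(\mathfrak{sl}_2\) spanned by \(\mathbf h,\mathbf x^2,\mathbf y^2\)), then \(\Phi\) induces a linear automorphism \(\Phi\) of \(H_{m/n}\), and for every \(N\) there is a sign \(\varepsilon_N\in\{1,-1\}\) with \(\Phi\circ d_N=\varepsilon_N\,d_{-N}\circ\Phi\). -/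

import Mathlib

open scoped BigOperators DirectSum

noncomputable section

namespace Cherednik

/-! ### The reflection representation and the rational Cherednik algebra of type `𝔰𝔩ₙ` -/

/-- The `(n-1)`-dimensional reflection representation of `S_n`, as the space of vectors of `ℂⁿ`
with coordinate sum zero. It serves both as `𝔥` (basis `y_i` of `ℂⁿ`) and as `𝔥*` (dual basis
`x_i`); the pairing between the two is the standard bilinear form `pairing` below. -/
def refl (n : ℕ) : Submodule ℂ (Fin n → ℂ) where
  carrier := {v | ∑ i, v i = 0}
  add_mem' := by
    intro a b ha hb
    simp only [Set.mem_ofPred_eq, Pi.add_apply, Finset.sum_add_distrib] at *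
    rw [ha, hb, add_zero]
  zero_mem' := by simp
  smul_mem' := by
    intro r a ha
    simp only [Set.mem_ofPred_eq, Pi.smul_apply, smul_eq_mul, ← Finset.mul_sum] at *
    rw [ha, mul_zero]

/-- The action of a permutation on the reflection representation: `e_i ↦ e_{σ i}`. -/
def perm {n : ℕ} (σ : Equiv.Perm (Fin n)) : refl n →ₗ[ℂ] refl n where
  toFun v := ⟨fun i => v.1 (σ⁻¹ i), by
    have h : ∑ i, v.1 i = 0 := v.2
    show ∑ i, v.1 (σ⁻¹ i) = 0
    rw [← h]
    exact Equiv.sum_comp (σ⁻¹) v.1⟩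
  map_add' _ _ := rfl
  map_smul' _ _ := rfl

/-- The pairing `⟨y, x⟩ = ∑ y_i x_i` between `𝔥` and `𝔥*`. -/
def pairing {n : ℕ} (v w : refl n) : ℂ := ∑ i, v.1 i * w.1 i

/-- Generators of the rational Cherednik algebra. -/
inductive Gen (n : ℕ) : Type
  | x (v : refl n) : Gen n
  | y (v : refl n) : Gen n
  | s (σ : Equiv.Perm (Fin n)) : Gen n

/-- The free algebra on the generators. -/
abbrev Free (n : ℕ) : Type := FreeAlgebra ℂ (Gen n)

/-- A generator `x`, for `v ∈ 𝔥*`, in the free algebra. -/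
abbrev fx {n : ℕ} (v : refl n) : Free n := FreeAlgebra.ι ℂ (Gen.x v)
/-- A generator `y`, for `v ∈ 𝔥`, in the free algebra. -/
abbrev fy {n : ℕ} (v : refl n) : Free n := FreeAlgebra.ι ℂ (Gen.y v)
/-- A group element in the free algebra. -/
abbrev fs {n : ℕ} (σ : Equiv.Perm (Fin n)) : Free n := FreeAlgebra.ι ℂ (Gen.s σ)

/-- The defining relations of the rational Cherednik algebra `𝐇_c`. The sum in the last relation
runs over the transpositions `(i j)`, `i < j`, with root `x_i - x_j` and coroot `y_i - y_j`. -/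
inductive Rel (n : ℕ) (c : ℂ) : Free n → Free n → Prop
  | x_add (v w : refl n) : Rel n c (fx (v + w)) (fx v + fx w)
  | x_smul (r : ℂ) (v : refl n) : Rel n c (fx (r • v)) (r • fx v)
  | y_add (v w : refl n) : Rel n c (fy (v + w)) (fy v + fy w)
  | y_smul (r : ℂ) (v : refl n) : Rel n c (fy (r • v)) (r • fy v)
  | s_one : Rel n c (fs 1) 1
  | s_mul (σ τ : Equiv.Perm (Fin n)) : Rel n c (fs (σ * τ)) (fs σ * fs τ)
  | s_x (σ : Equiv.Perm (Fin n)) (v : refl n) : Rel n c (fs σ * fx v) (fx (perm σ v) * fs σ)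
  | s_y (σ : Equiv.Perm (Fin n)) (v : refl n) : Rel n c (fs σ * fy v) (fy (perm σ v) * fs σ)
  | x_comm (v w : refl n) : Rel n c (fx v * fx w) (fx w * fx v)
  | y_comm (v w : refl n) : Rel n c (fy v * fy w) (fy w * fy v)
  | y_x (v w : refl n) : Rel n c (fy v * fx w - fx w * fy v)
      (algebraMap ℂ (Free n) (pairing v w) -
        c • ∑ i : Fin n, ∑ j ∈ Finset.univ.filter (fun j => i < j),
          ((v.1 i - v.1 j) * (w.1 i - w.1 j)) • fs (Equiv.swap i j))

/-- The rational Cherednik algebra `𝐇_c` of type `𝔰𝔩ₙ`. -/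
def Alg (n : ℕ) (c : ℂ) : Type := RingQuot (Rel n c)

instance (n : ℕ) (c : ℂ) : Ring (Alg n c) := inferInstanceAs (Ring (RingQuot (Rel n c)))
instance (n : ℕ) (c : ℂ) : Algebra ℂ (Alg n c) :=
  inferInstanceAs (Algebra ℂ (RingQuot (Rel n c)))

/-- The quotient map from the free algebra. -/
def toAlg (n : ℕ) (c : ℂ) : Free n →ₐ[ℂ] Alg n c := RingQuot.mkAlgHom ℂ (Rel n c)

lemma toAlg_rel {n : ℕ} {c : ℂ} {a b : Free n} (h : Rel n c a b) : toAlg n c a = toAlg n c b :=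
  RingQuot.mkAlgHom_rel ℂ h

variable {n : ℕ} {c : ℂ}

/-- The element of `𝐇_c` given by a vector of `𝔥*`. -/
def X (c : ℂ) (v : refl n) : Alg n c := toAlg n c (fx v)
/-- The element of `𝐇_c` given by a vector of `𝔥`. -/
def Y (c : ℂ) (v : refl n) : Alg n c := toAlg n c (fy v)
/-- The element of `𝐇_c` given by a permutation. -/
def S (c : ℂ) (σ : Equiv.Perm (Fin n)) : Alg n c := toAlg n c (fs σ)

/-- The images of the generators under the Fourier transform: `x ↦ y`, `y ↦ -x`, `σ ↦ σ`. -/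
def fourierGen (n : ℕ) (c : ℂ) : Gen n → Alg n c
  | Gen.x v => Y c v
  | Gen.y v => - X c v
  | Gen.s σ => S c σ

/-- The Fourier transform `Φ : 𝐇_c → 𝐇_c`. -/
def fourier (n : ℕ) (c : ℂ) : Alg n c →ₐ[ℂ] Alg n c :=
  RingQuot.liftAlgHom ℂ ⟨FreeAlgebra.lift ℂ (fourierGen n c), by
    intro a b h
    induction h with
    | x_add v w => simpa [fourierGen, Y] using toAlg_rel (Rel.y_add (c := c) v w)
    | x_smul r v => simpa [fourierGen, Y] using toAlg_rel (Rel.y_smul (c := c) r v)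
    | y_add v w =>
      have := toAlg_rel (Rel.x_add (c := c) v w)
      simp only [map_add] at this
      simp [fourierGen, X, this, add_comm]
    | y_smul r v =>
      have := toAlg_rel (Rel.x_smul (c := c) r v)
      simp only [map_smul] at this
      simp [fourierGen, X, this]
    | s_one => simpa [fourierGen, S] using toAlg_rel (Rel.s_one (n := n) (c := c))
    | s_mul σ τ => simpa [fourierGen, S] using toAlg_rel (Rel.s_mul (c := c) σ τ)
    | s_x σ v => simpa [fourierGen, S, Y] using toAlg_rel (Rel.s_y (c := c) σ v)
    | s_y σ v => simpa [fourierGen, S, X] using toAlg_rel (Rel.s_x (c := c) σ v)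
    | x_comm v w => simpa [fourierGen, Y] using toAlg_rel (Rel.y_comm (c := c) v w)
    | y_comm v w => simpa [fourierGen, X] using toAlg_rel (Rel.x_comm (c := c) v w)
    | y_x v w =>
      have := toAlg_rel (Rel.y_x (c := c) w v)
      simp only [map_sub, map_mul, AlgHom.commutes, map_smul, map_sum] at this
      simp only [map_sub, map_mul, AlgHom.commutes, map_smul, map_sum, FreeAlgebra.lift_ι_apply,
        fourierGen, X, Y, S]
      have hp : pairing v w = pairing w v := by simp [pairing, mul_comm]
      rw [hp]
      calc _ = toAlg n c (fy w) * toAlg n c (fx v) - toAlg n c (fx v) * toAlg n c (fy w) := by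
            noncomm_ring
        _ = _ := by rw [this]; simp only [mul_comm]⟩

/-- The step `𝒢_i` of the filtration of `𝐇_c`: the span of the products of at most `i` elements of
`𝔥 ∪ 𝔥*` and arbitrarily many elements of `S_n`. -/
def G (n : ℕ) (c : ℂ) (i : ℕ) : Submodule ℂ (Alg n c) :=
  Submodule.span ℂ (Set.range (S c)) *
    ((1 ⊔ Submodule.span ℂ (Set.range (X c) ∪ Set.range (Y c))) *
      Submodule.span ℂ (Set.range (S c))) ^ i

/-- The orthogonal projection of the `i`-th standard basis vector of `ℂⁿ` to the reflection
representation; as an element of `𝔥*` it is `x̃_i = x_i - (1/n) ∑_j x_j`, and similarly `ỹ_i`. -/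
def proj (i : Fin n) : refl n :=
  ⟨fun j => (if j = i then 1 else 0) - 1 / (n : ℂ), by
    have hn : (n : ℂ) ≠ 0 := by
      have := i.pos
      exact_mod_cast this.ne'
    show ∑ j, ((if j = i then (1 : ℂ) else 0) - 1 / (n : ℂ)) = 0
    simp [Finset.sum_sub_distrib, hn]⟩

/-- `x̃_i = x_i - (1/n) ∑_j x_j`. -/
def xt (c : ℂ) (i : Fin n) : Alg n c := X c (proj i)
/-- `ỹ_i = y_i - (1/n) ∑_j y_j`. -/
def yt (c : ℂ) (i : Fin n) : Alg n c := Y c (proj i)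

/-- The grading element `𝐡 = ½ ∑ (x̃_i ỹ_i + ỹ_i x̃_i)`. -/
def euler (n : ℕ) (c : ℂ) : Alg n c :=
  (1 / 2 : ℂ) • ∑ i : Fin n, (xt c i * yt c i + yt c i * xt c i)

/-- `𝐱² = ∑ x̃_i²`, that is `∑ x_i² - (1/n) (∑ x_i)²`. -/
def xsq (n : ℕ) (c : ℂ) : Alg n c := ∑ i : Fin n, xt c i ^ 2
/-- `𝐲² = ∑ ỹ_i²`, that is `∑ y_i² - (1/n) (∑ y_i)²`. -/
def ysq (n : ℕ) (c : ℂ) : Alg n c := ∑ i : Fin n, yt c i ^ 2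

/-! ### The maps `α_N : 𝔥 → 𝐇_c` -/

/-- The linear map `𝔥 → 𝐇_c`, `∑ v_i y_i ↦ ∑ v_i a_i`. -/
def ofCoeffs (a : Fin n → Alg n c) : refl n →ₗ[ℂ] Alg n c :=
  ∑ i : Fin n, ((LinearMap.proj i : (Fin n → ℂ) →ₗ[ℂ] ℂ).comp (refl n).subtype).smulRight (a i)

/-- The maps `α_N : 𝔥 → 𝐇_c`: for `N > 0` the one with coefficients `x̃_i ^ N`,
for `N = 0` the one with coefficients `x̃_i ỹ_i`, and `α_{-N} = Φ ∘ α_N` for `N > 0`. Evaluated at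
`proj i`, these are `x̃_i ^ N - (1/n) ∑_j x̃_j ^ N` and `x̃_i ỹ_i - (1/n) ∑_j x̃_j ỹ_j`. -/
def alpha (n : ℕ) (c : ℂ) (N : ℤ) : refl n →ₗ[ℂ] Alg n c :=
  if 0 < N then ofCoeffs (fun i => xt c i ^ N.natAbs)
  else if N = 0 then ofCoeffs (fun i => xt c i * yt c i)
  else (fourier n c).toLinearMap.comp (ofCoeffs (fun i => xt c i ^ N.natAbs))

/-- The filtration degree of `α_N`: `|N|` for `N ≠ 0`, and `2` for `N = 0`. -/
def wt (N : ℤ) : ℕ := if N = 0 then 2 else N.natAbs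

/-! ### Modules, compatible filtrations and `Hom_{S_n}(Λ*𝔥, gr L)` -/

/-- The exterior algebra `Λ*𝔥`. -/
abbrev Ext (n : ℕ) : Type := ExteriorAlgebra ℂ (refl n)

/-- The action of a permutation on `Λ*𝔥`. -/
def extPerm (σ : Equiv.Perm (Fin n)) : Ext n →ₐ[ℂ] Ext n := ExteriorAlgebra.map (perm σ)

section Modules

variable (n c)
variable (L : Type*) [AddCommGroup L] [Module ℂ L] [Module (Alg n c) L]
  [IsScalarTower ℂ (Alg n c) L]

/-- The operator on `L` by which an element of `𝐇_c` acts. -/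
def act (a : Alg n c) : Module.End ℂ L := Algebra.lsmul ℂ ℂ L a

/-- The exponential series of a nilpotent endomorphism of a complex vector space. -/
def expEnd (T : Module.End ℂ L) : Module.End ℂ L :=
  letI : Module ℚ (Module.End ℂ L) := Module.compHom _ (algebraMap ℚ ℂ)
  IsNilpotent.exp T

/-- The Fourier transform on a finite-dimensional `𝐇_c`-module. The elements `𝐡`, `𝐱²/2`, `-𝐲²/2`
form an `𝔰𝔩₂`-triple; `𝐱²` and `𝐲²` act nilpotently, and the Fourier transform is the element
`exp(𝐱²/2) exp(𝐲²/2) exp(𝐱²/2)` of the integrated `SL₂(ℂ)`-action. -/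
def fourierMod : Module.End ℂ L :=
  expEnd L (act n c L ((1 / 2 : ℂ) • xsq n c)) * expEnd L (act n c L ((1 / 2 : ℂ) • ysq n c)) *
    expEnd L (act n c L ((1 / 2 : ℂ) • xsq n c))

/-- An increasing `ℤ`-filtration of `L` compatible with the filtration `𝒢` of `𝐇_c` and with the
grading of `L` by eigenvalues of `𝐡`. -/
structure Filtr where
  /-- The steps of the filtration. -/
  F : ℤ → Submodule ℂ L
  mono : Monotone F
  smul_mem : ∀ (i : ℕ) (j : ℤ) (a : Alg n c) (v : L), a ∈ G n c i → v ∈ F j → a • v ∈ F (j + i)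
  euler_mem : ∀ (j : ℤ) (v : L), v ∈ F j → euler n c • v ∈ F j

end Modules

section Graded

variable {L : Type*} [AddCommGroup L] [Module ℂ L] [Module (Alg n c) L]
  [IsScalarTower ℂ (Alg n c) L]

lemma S_mem_G (σ : Equiv.Perm (Fin n)) : S c σ ∈ G n c 0 := by
  rw [G, pow_zero, mul_one]
  exact Submodule.subset_span ⟨σ, rfl⟩

/-- The filtration is preserved by the whole `𝔰𝔩₂` (it is preserved by `𝐡` by definition). -/
def Filtr.Sl2Stable (F : Filtr n c L) : Prop :=
  ∀ (j : ℤ) (v : L), v ∈ F.F j → xsq n c • v ∈ F.F j ∧ ysq n c • v ∈ F.F j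

/-- The graded piece `gr_j L = F_j / F_{j-1}`. -/
abbrev GrPart (F : Filtr n c L) (j : ℤ) : Type _ := F.F j ⧸ (F.F (j - 1)).submoduleOf (F.F j)

/-- The associated graded space `gr L = ⨁_j F_j / F_{j-1}`. -/
abbrev Gr (F : Filtr n c L) : Type _ := ⨁ j : ℤ, GrPart F j

/-- The class in `gr L` of an element of `F_j`: its image in the summand `F_j / F_{j-1}`. -/
def grClass (F : Filtr n c L) (j : ℤ) : F.F j →ₗ[ℂ] Gr F :=
  (DirectSum.lof ℂ ℤ (GrPart F) j).comp ((F.F (j - 1)).submoduleOf (F.F j)).mkQ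

lemma act_S_mem (F : Filtr n c L) (σ : Equiv.Perm (Fin n)) (j : ℤ) (v : L) (hv : v ∈ F.F j) :
    act n c L (S c σ) v ∈ F.F j := by
  have := F.smul_mem 0 j _ v (S_mem_G (c := c) σ) hv
  simpa [act] using this

/-- The action of a permutation on `gr L`. -/
def grPerm (F : Filtr n c L) (σ : Equiv.Perm (Fin n)) : Gr F →ₗ[ℂ] Gr F :=
  DirectSum.lmap fun j => Submodule.mapQ _ _
    ((act n c L (S c σ)).restrict (act_S_mem F σ j))
    (fun v hv => act_S_mem F σ (j - 1) v.1 hv)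

/-- `H^F = Hom_{S_n}(Λ*𝔥, gr^F L)`. -/
def H (F : Filtr n c L) : Submodule ℂ (Ext n →ₗ[ℂ] Gr F) where
  carrier := {φ | ∀ σ w, φ (extPerm σ w) = grPerm F σ (φ w)}
  add_mem' := by
    intro a b ha hb σ w
    simp [ha σ w, hb σ w]
  zero_mem' := by intro σ w; simp
  smul_mem' := by
    intro r a ha σ w
    simp [ha σ w]

/-- `φ : Λ*𝔥 → L` is `S_n`-equivariant. -/
def IsEquivariant (φ : Ext n →ₗ[ℂ] L) : Prop := ∀ σ w, φ (extPerm σ w) = S c σ • φ w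

/-- `φ : Λ*𝔥 → L` takes values in `F_j`, and `ψ ∈ H^F` is its class in `gr_j L`. -/
def IsClass (F : Filtr n c L) (j : ℤ) (φ : Ext n →ₗ[ℂ] L) (ψ : H F) : Prop :=
  ∀ w, ∃ h : φ w ∈ F.F j, ψ.1 w = grClass F j ⟨φ w, h⟩

/-- Contraction with `α : 𝔥 → 𝐇_c`: the composition
`Λ^{k-1}𝔥 → 𝔥 ⊗ Λ^k 𝔥 → 𝐇_c ⊗ L → L` of the dual of the contraction map, of `α ⊗ φ` and of the
action. The first map is `w ↦ ∑ e_i ⊗ (e_i ∧ w)` for an orthonormal basis `e_i` of `𝔥`; the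
canonical tensor `∑ e_i ⊗ e_i` is also `∑_i proj i ⊗ proj i`. -/
def contract (α : refl n →ₗ[ℂ] Alg n c) (φ : Ext n →ₗ[ℂ] L) : Ext n →ₗ[ℂ] L :=
  ∑ i : Fin n, (act n c L (α (proj i))).comp
    (φ.comp (LinearMap.mulLeft ℂ (ExteriorAlgebra.ι ℂ (proj i))))

/-- `d : H^F → H^F` is the map on associated graded spaces induced by a map `∂` which carries
equivariant maps with values in `F_j` to maps with values in `F_{j+i}`. -/
def IsInduced (F : Filtr n c L) (i : ℕ) (del : (Ext n →ₗ[ℂ] L) → (Ext n →ₗ[ℂ] L))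
    (d : Module.End ℂ (H F)) : Prop :=
  ∀ (j : ℤ) (φ : Ext n →ₗ[ℂ] L) (ψ : H F),
    IsEquivariant (c := c) φ → IsClass F j φ ψ → IsClass F (j + i) (del φ) (d ψ)

/-- The part of `gr_f L` of `q`-degree `q`; the `q`-grading is twice the grading by eigenvalues
of `𝐡`. -/
def grPiece (F : Filtr n c L) (q f : ℤ) : Submodule ℂ (Gr F) :=
  (((act n c L ((2 : ℂ) • euler n c)).eigenspace (q : ℂ)).comap (F.F f).subtype).map (grClass F f)

/-- The part of `H^F` of tridegree `(a, q, f)`: the `a`-grading is `(n-1)(m-1) + 2k` on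
`Hom_{S_n}(Λ^k 𝔥, gr L)`, the `q`-grading is twice the grading by eigenvalues of `𝐡`, and `f` is
the filtration grading. -/
def piece (F : Filtr n c L) (m a q f : ℤ) : Submodule ℂ (H F) where
  carrier := {ψ | (∀ k : ℕ, ((n : ℤ) - 1) * (m - 1) + 2 * k ≠ a →
      ∀ w ∈ ⋀[ℂ]^k (refl n), ψ.1 w = 0) ∧ ∀ w, ψ.1 w ∈ grPiece F q f}
  add_mem' := by
    rintro ψ χ ⟨h1, h2⟩ ⟨h3, h4⟩
    refine ⟨fun k hk w hw => ?_, fun w => ?_⟩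
    · simp [h1 k hk w hw, h3 k hk w hw]
    · exact Submodule.add_mem _ (h2 w) (h4 w)
  zero_mem' := ⟨fun _ _ _ _ => rfl, fun _ => Submodule.zero_mem _⟩
  smul_mem' := by
    rintro r ψ ⟨h1, h2⟩
    refine ⟨fun k hk w hw => ?_, fun w => ?_⟩
    · simp [h1 k hk w hw]
    · exact Submodule.smul_mem _ r (h2 w)

end Graded

end Cherednik

end

noncomputable section

namespace Cherednik

/-! ### Relations in the rational Cherednik algebra -/

section Algebra

variable {n : ℕ} {c : ℂ}

/-! The only generators among `x`, `y` that fail to commute have `[y, x]` in the group algebra,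
which preserves every step of the filtration of `L`. By the Leibniz rule, commutators of polynomials
in `𝔥 ∪ 𝔥*` have smaller filtration degree than expected, so on `gr L` all the operators `α_N(v)`
commute (`act_comm_mem_shift`, `grAlpha_commute`). Contraction pairs these commuting operators with
anticommuting exterior multiplications, as in a Koszul complex, and the differentials therefore
anticommute.

Uniqueness holds because every homogeneous class in `H` lifts to an equivariant map into `L`, by
averaging a linear lift over `S_n` (`exists_isClass`), and `H` is spanned by homogeneous classes.

The `q`-shift comes from `[𝐡, α_N(v)] = N α_N(v)`. It rests, like the `𝔰𝔩₂`-relations, on the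
cancellation of reflection terms in `sum_comm_X`.

The elements `𝐱²/2` and `𝐲²/2` act nilpotently, and their exponentials act by conjugation on each
pair `X v`, `Y v` as elementary `2 × 2` matrices. The triple product is the Weyl element `X ↦ Y`, `Y
↦ -X`, so it intertwines the algebra endomorphism `Φ`. Finally, `Φ ∘ α_N` is `±α_{-N}` exactly for
`N ≠ 0`, and modulo the group algebra for `N = 0`; on `gr L` the error disappears. -/

lemma X_add (v w : refl n) : X c (v + w) = X c v + X c w := by
  simpa [X] using toAlg_rel (Rel.x_add (c := c) v w)

lemma X_smul (r : ℂ) (v : refl n) : X c (r • v) = r • X c v := by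
  simpa [X] using toAlg_rel (Rel.x_smul (c := c) r v)

lemma Y_add (v w : refl n) : Y c (v + w) = Y c v + Y c w := by
  simpa [Y] using toAlg_rel (Rel.y_add (c := c) v w)

lemma Y_smul (r : ℂ) (v : refl n) : Y c (r • v) = r • Y c v := by
  simpa [Y] using toAlg_rel (Rel.y_smul (c := c) r v)

lemma S_one : S c (1 : Equiv.Perm (Fin n)) = 1 := by
  simpa [S] using toAlg_rel (Rel.s_one (n := n) (c := c))

lemma S_mul (σ τ : Equiv.Perm (Fin n)) : S c (σ * τ) = S c σ * S c τ := by
  simpa [S] using toAlg_rel (Rel.s_mul (c := c) σ τ)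

lemma S_mul_X (σ : Equiv.Perm (Fin n)) (v : refl n) :
    S c σ * X c v = X c (perm σ v) * S c σ := by
  simpa [S, X] using toAlg_rel (Rel.s_x (c := c) σ v)

lemma S_mul_Y (σ : Equiv.Perm (Fin n)) (v : refl n) :
    S c σ * Y c v = Y c (perm σ v) * S c σ := by
  simpa [S, Y] using toAlg_rel (Rel.s_y (c := c) σ v)

lemma X_comm (v w : refl n) : X c v * X c w = X c w * X c v := by
  simpa [X] using toAlg_rel (Rel.x_comm (c := c) v w)

lemma Y_comm (v w : refl n) : Y c v * Y c w = Y c w * Y c v := by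
  simpa [Y] using toAlg_rel (Rel.y_comm (c := c) v w)

lemma Y_mul_X_sub (v w : refl n) :
    Y c v * X c w - X c w * Y c v = pairing v w • (1 : Alg n c) -
      c • ∑ i : Fin n, ∑ j ∈ Finset.univ.filter (fun j => i < j),
          ((v.1 i - v.1 j) * (w.1 i - w.1 j)) • S c (Equiv.swap i j) := by
  have := toAlg_rel (Rel.y_x (c := c) v w)
  simp only [map_sub, map_mul, map_smul, map_sum, Algebra.algebraMap_eq_smul_one, map_one]
    at this
  exact this

/-- `X` as a linear map. -/
def Xlin (n : ℕ) (c : ℂ) : refl n →ₗ[ℂ] Alg n c where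
  toFun := X c
  map_add' := X_add
  map_smul' := X_smul

/-- `Y` as a linear map. -/
def Ylin (n : ℕ) (c : ℂ) : refl n →ₗ[ℂ] Alg n c where
  toFun := Y c
  map_add' := Y_add
  map_smul' := Y_smul

@[simp] lemma Xlin_apply (v : refl n) : Xlin n c v = X c v := rfl
@[simp] lemma Ylin_apply (v : refl n) : Ylin n c v = Y c v := rfl

lemma fourier_toAlg (g : Gen n) : fourier n c (toAlg n c (FreeAlgebra.ι ℂ g)) = fourierGen n c g := by
  unfold fourier toAlg
  erw [RingQuot.liftAlgHom_mkAlgHom_apply]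
  simp

lemma fourier_X (v : refl n) : fourier n c (X c v) = Y c v := fourier_toAlg _
lemma fourier_Y (v : refl n) : fourier n c (Y c v) = -X c v := fourier_toAlg _
lemma fourier_S (σ : Equiv.Perm (Fin n)) : fourier n c (S c σ) = S c σ := fourier_toAlg _

/-- Induction principle for the rational Cherednik algebra. -/
lemma Alg.induction {p : Alg n c → Prop} (scalar : ∀ r : ℂ, p (algebraMap ℂ _ r))
    (hX : ∀ v, p (X c v)) (hY : ∀ v, p (Y c v)) (hS : ∀ σ, p (S c σ))
    (mul : ∀ a b, p a → p b → p (a * b)) (add : ∀ a b, p a → p b → p (a + b)) (a : Alg n c) :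
    p a := by
  obtain ⟨a, rfl⟩ : ∃ b, toAlg n c b = a := RingQuot.mkAlgHom_surjective ℂ (Rel n c) a
  induction a using FreeAlgebra.induction with
  | grade0 r => simpa using scalar r
  | grade1 g =>
    cases g with
    | x v => exact hX v
    | y v => exact hY v
    | s σ => exact hS σ
  | mul a b ha hb => simpa using mul _ _ ha hb
  | add a b ha hb => simpa using add _ _ ha hb

/-! ### The projections of the standard basis -/

lemma perm_proj (σ : Equiv.Perm (Fin n)) (i : Fin n) : perm σ (proj i) = proj (σ i) := by
  apply Subtype.ext
  funext j
  simp [perm, proj, Equiv.symm_apply_eq]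

/-- The vectors `proj i` are linearly dependent, but they form a Parseval frame: since the
coordinates of `v` sum to zero, the mean corrections cancel. Thus they can replace an orthonormal
basis. -/
lemma sum_coord_smul_proj (v : refl n) : ∑ i, v.1 i • proj i = v := by
  have hv : ∑ i, v.1 i = 0 := v.2
  apply Subtype.ext
  funext j
  simp [proj, Finset.sum_apply, mul_sub, Finset.sum_sub_distrib, ← Finset.sum_mul, hv]

lemma pairing_proj_left (i : Fin n) (v : refl n) : pairing (proj i) v = v.1 i := by
  have hv : ∑ i, v.1 i = 0 := v.2
  simp [pairing, proj, sub_mul, Finset.sum_sub_distrib, ← Finset.mul_sum, hv]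

lemma sum_coord_smul (f : refl n →ₗ[ℂ] Alg n c) (v : refl n) :
    ∑ i, v.1 i • f (proj i) = f v := by
  conv_rhs => rw [← sum_coord_smul_proj v]
  simp

lemma sum_proj_sub_smul (f : refl n →ₗ[ℂ] Alg n c) (a b : Fin n) :
    ∑ i, ((proj i).1 a - (proj i).1 b) • f (proj i) = f (proj a) - f (proj b) := by
  simp [proj, sub_smul, Finset.sum_sub_distrib]

lemma perm_swap_proj_sub (a b : Fin n) :
    perm (Equiv.swap a b) (proj a) - perm (Equiv.swap a b) (proj b) = proj b - proj a := by
  simp [perm_proj]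

/-- For `f = X` or `f = Y`, the identity `∑ᵢ (f(pᵢ)[ỹᵢ, x] + [ỹᵢ, x] f(pᵢ)) = 2 f(x)`: the
reflection terms cancel. -/
lemma sum_comm_X (f : refl n →ₗ[ℂ] Alg n c)
    (hf : ∀ (σ : Equiv.Perm (Fin n)) v, S c σ * f v = f (perm σ v) * S c σ) (v : refl n) :
    ∑ i, (f (proj i) * (yt c i * X c v - X c v * yt c i) +
      (yt c i * X c v - X c v * yt c i) * f (proj i)) = (2 : ℂ) • f v := by
  -- For the reflection `s` in the root `α = e_a - e_b`, summing over the frame turns `∑ ⟨pᵢ, α⟩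
  -- f(pᵢ)` into `f(α)`. Since `s f(α) = -f(α) s`, the anticommutator vanishes.
  have key : ∀ a b : Fin n,
      ∑ i, (((proj i).1 a - (proj i).1 b) * (v.1 a - v.1 b)) •
        (f (proj i) * S c (Equiv.swap a b) + S c (Equiv.swap a b) * f (proj i)) = 0 := by
    intro a b
    have h1 : ∑ i, (((proj i).1 a - (proj i).1 b) * (v.1 a - v.1 b)) •
        (f (proj i) * S c (Equiv.swap a b) + S c (Equiv.swap a b) * f (proj i)) =
        (v.1 a - v.1 b) • ((∑ i, ((proj i).1 a - (proj i).1 b) • f (proj i)) *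
          S c (Equiv.swap a b) + S c (Equiv.swap a b) *
            (∑ i, ((proj i).1 a - (proj i).1 b) • f (proj i))) := by
      rw [Finset.sum_mul, Finset.mul_sum, ← Finset.sum_add_distrib, Finset.smul_sum]
      refine Finset.sum_congr rfl fun i _ => ?_
      rw [mul_comm, mul_smul]
      simp [smul_add]
    rw [h1, sum_proj_sub_smul, ← map_sub, hf, map_sub (perm _), perm_swap_proj_sub, ← add_mul, ← map_add]
    simp
  have h2 : ∀ i, f (proj i) * (yt c i * X c v - X c v * yt c i) +
      (yt c i * X c v - X c v * yt c i) * f (proj i) =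
      (2 : ℂ) • (v.1 i • f (proj i)) - c • ∑ a : Fin n, ∑ b ∈ Finset.univ.filter (fun j => a < j),
        (((proj i).1 a - (proj i).1 b) * (v.1 a - v.1 b)) •
          (f (proj i) * S c (Equiv.swap a b) + S c (Equiv.swap a b) * f (proj i)) := by
    intro i
    rw [yt, Y_mul_X_sub, pairing_proj_left]
    simp only [mul_sub, sub_mul, mul_smul_comm, smul_mul_assoc, mul_one, one_mul, Finset.mul_sum,
      Finset.sum_mul, smul_add, Finset.sum_add_distrib, two_smul]
    abel
  simp_rw [h2]
  rw [Finset.sum_sub_distrib, ← Finset.smul_sum, sum_coord_smul, ← Finset.smul_sum,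
    Finset.sum_comm]
  rw [Finset.sum_eq_zero, smul_zero, sub_zero]
  intro a _
  rw [Finset.sum_comm]
  exact Finset.sum_eq_zero fun b _ => key a b

/-! ### Commutators of `𝐡`, `𝐱²`, `𝐲²` with the generators. -/

lemma euler_mul_X (v : refl n) : euler n c * X c v = X c v * (euler n c + 1) := by
  have h := sum_comm_X (c := c) (Xlin n c) (fun σ v => S_mul_X σ v) v
  have h2 : euler n c * X c v - X c v * euler n c = X c v := by
    have : euler n c * X c v - X c v * euler n c = (1 / 2 : ℂ) • ((2 : ℂ) • X c v) := by
      rw [← Xlin_apply (c := c) v, ← h, euler]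
      simp only [smul_mul_assoc, mul_smul_comm, ← smul_sub, Finset.sum_mul, Finset.mul_sum,
        ← Finset.sum_sub_distrib, Xlin_apply]
      congr 1
      refine Finset.sum_congr rfl fun i _ => ?_
      have := X_comm (c := c) v (proj i)
      rw [← xt] at this ⊢
      have e1 : xt c i * yt c i * X c v - X c v * (xt c i * yt c i) =
        xt c i * (yt c i * X c v - X c v * yt c i) := by
        rw [← mul_assoc, this]; noncomm_ring
      have e2 : yt c i * xt c i * X c v - X c v * (yt c i * xt c i) =
        (yt c i * X c v - X c v * yt c i) * xt c i := by
        rw [mul_assoc, ← this]; noncomm_ring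
      rw [← e1, ← e2]; noncomm_ring
    rw [this, smul_smul]; norm_num
  rw [mul_add, mul_one, ← sub_eq_iff_eq_add', h2]

lemma ysq_mul_X (v : refl n) : ysq n c * X c v = X c v * ysq n c + (2 : ℂ) • Y c v := by
  have h := sum_comm_X (c := c) (Ylin n c) (fun σ v => S_mul_Y σ v) v
  rw [← sub_eq_iff_eq_add', ← Ylin_apply (c := c) v, ← h, ysq]
  simp only [Finset.sum_mul, Finset.mul_sum, ← Finset.sum_sub_distrib, Ylin_apply]
  refine Finset.sum_congr rfl fun i _ => ?_
  rw [← yt]; noncomm_ring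

lemma fourier_xt (i : Fin n) : fourier n c (xt c i) = yt c i := fourier_X _
lemma fourier_yt (i : Fin n) : fourier n c (yt c i) = -xt c i := fourier_Y _

lemma fourier_euler : fourier n c (euler n c) = -euler n c := by
  simp only [euler, map_smul, map_sum, map_add, map_mul, fourier_xt, fourier_yt, ← smul_neg,
    ← Finset.sum_neg_distrib]
  congr 1
  refine Finset.sum_congr rfl fun i _ => ?_
  noncomm_ring

lemma fourier_xsq : fourier n c (xsq n c) = ysq n c := by
  simp [xsq, ysq, fourier_xt]

lemma fourier_ysq : fourier n c (ysq n c) = xsq n c := by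
  simp [xsq, ysq, fourier_yt]

/-- Apply `Φ` to the relation for `X`: it sends `X` to `Y` and `𝐡` to `-𝐡`. Other relations for `Y`
are transported in the same way. -/
lemma euler_mul_Y (v : refl n) : euler n c * Y c v = Y c v * (euler n c - 1) := by
  have h := congrArg (fourier n c) (euler_mul_X (c := c) v)
  simp only [map_mul, map_add, map_one, fourier_euler, fourier_X] at h
  rw [neg_mul] at h
  rw [← neg_inj, h]; noncomm_ring

lemma xsq_mul_Y (v : refl n) : xsq n c * Y c v = Y c v * xsq n c - (2 : ℂ) • X c v := by
  have h := congrArg (fourier n c) (ysq_mul_X (c := c) v)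
  simp only [map_mul, map_add, map_smul, fourier_ysq, fourier_X, fourier_Y] at h
  rw [h, smul_neg, sub_eq_add_neg]

lemma xsq_mul_X (v : refl n) : xsq n c * X c v = X c v * xsq n c := by
  have : Commute (X c v) (xsq n c) :=
    Commute.sum_right _ _ _ fun i _ => Commute.pow_right (X_comm (c := c) v (proj i)) 2
  exact this.symm

lemma ysq_mul_Y (v : refl n) : ysq n c * Y c v = Y c v * ysq n c := by
  have : Commute (Y c v) (ysq n c) :=
    Commute.sum_right _ _ _ fun i _ => Commute.pow_right (Y_comm (c := c) v (proj i)) 2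
  exact this.symm

lemma S_mul_xt (σ : Equiv.Perm (Fin n)) (i : Fin n) : S c σ * xt c i = xt c (σ i) * S c σ := by
  rw [xt, S_mul_X, perm_proj, xt]

lemma S_mul_xt_pow (σ : Equiv.Perm (Fin n)) (i : Fin n) (k : ℕ) :
    S c σ * xt c i ^ k = xt c (σ i) ^ k * S c σ :=
  SemiconjBy.pow_right (S_mul_xt σ i) k

lemma S_mul_yt (σ : Equiv.Perm (Fin n)) (i : Fin n) : S c σ * yt c i = yt c (σ i) * S c σ := by
  rw [yt, S_mul_Y, perm_proj, yt]

lemma S_mul_xsq (σ : Equiv.Perm (Fin n)) : S c σ * xsq n c = xsq n c * S c σ := by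
  rw [xsq, Finset.mul_sum, Finset.sum_mul, ← Equiv.sum_comp σ (fun i => xt c i ^ 2 * S c σ)]
  exact Finset.sum_congr rfl fun i _ => S_mul_xt_pow σ i 2

lemma S_mul_ysq (σ : Equiv.Perm (Fin n)) : S c σ * ysq n c = ysq n c * S c σ := by
  rw [← fourier_xsq, ← fourier_S (c := c), ← map_mul, S_mul_xsq, map_mul]

lemma euler_mul_xt_pow (i : Fin n) (k : ℕ) :
    euler n c * xt c i ^ k = xt c i ^ k * (euler n c + (k : ℂ) • (1 : Alg n c)) := by
  induction k with
  | zero => simp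
  | succ k ih =>
    rw [pow_succ, ← mul_assoc, ih, mul_assoc, add_mul, xt, euler_mul_X, mul_assoc]
    congr 1
    simp only [smul_mul_assoc, one_mul, mul_add, mul_one, mul_smul_comm, Nat.cast_succ, add_smul,
      one_smul]
    abel

lemma euler_mul_xsq : euler n c * xsq n c = xsq n c * (euler n c + (2 : ℂ) • (1 : Alg n c)) := by
  rw [xsq, Finset.mul_sum, Finset.sum_mul]
  exact Finset.sum_congr rfl fun i _ => by simpa using euler_mul_xt_pow (c := c) i 2

lemma euler_mul_ysq : euler n c * ysq n c = ysq n c * (euler n c + (-2 : ℂ) • (1 : Alg n c)) := by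
  have h := congrArg (fourier n c) (euler_mul_xsq (n := n) (c := c))
  simp only [map_mul, map_add, map_smul, map_one, fourier_xsq, fourier_euler] at h
  rw [← neg_inj, ← neg_mul, h, ← mul_neg, neg_add, ← neg_smul, neg_neg]

/-! ### The maps `α_N` -/

lemma ofCoeffs_apply (a : Fin n → Alg n c) (v : refl n) : ofCoeffs a v = ∑ i, v.1 i • a i := by
  simp [ofCoeffs]

lemma alpha_of_pos {N : ℤ} (h : 0 < N) : alpha n c N = ofCoeffs (fun i => xt c i ^ N.natAbs) :=
  if_pos h

lemma alpha_zero : alpha n c 0 = ofCoeffs (fun i => xt c i * yt c i) := by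
  simp [alpha]

lemma alpha_of_neg {N : ℤ} (h : N < 0) (v : refl n) :
    alpha n c N v = ∑ i, v.1 i • yt c i ^ N.natAbs := by
  rw [alpha, if_neg h.not_gt, if_neg h.ne]
  simp [ofCoeffs_apply, fourier_xt]

/-- `α_N` has coefficients `x̃_i ^ N`, `x̃_i ỹ_i` or `ỹ_i ^ (-N)` according to the sign of `N`. -/
def alphaCoeff (c : ℂ) (N : ℤ) (i : Fin n) : Alg n c :=
  if 0 < N then xt c i ^ N.natAbs else if N = 0 then xt c i * yt c i else yt c i ^ N.natAbs

lemma alpha_apply (N : ℤ) (v : refl n) : alpha n c N v = ∑ i, v.1 i • alphaCoeff c N i := by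
  rcases lt_trichotomy N 0 with h | rfl | h
  · simp [alpha_of_neg h, alphaCoeff, h.not_gt, h.ne]
  · simp [alpha_zero, alphaCoeff, ofCoeffs_apply]
  · simp [alpha_of_pos h, alphaCoeff, ofCoeffs_apply, h]

lemma S_mul_alphaCoeff (N : ℤ) (σ : Equiv.Perm (Fin n)) (i : Fin n) :
    S c σ * alphaCoeff c N i = alphaCoeff c N (σ i) * S c σ := by
  unfold alphaCoeff
  split_ifs
  · exact S_mul_xt_pow σ i _
  · exact SemiconjBy.mul_right (S_mul_xt σ i) (S_mul_yt σ i)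
  · exact SemiconjBy.pow_right (S_mul_yt σ i) _

lemma alpha_perm (N : ℤ) (σ : Equiv.Perm (Fin n)) (v : refl n) :
    alpha n c N (perm σ v) * S c σ = S c σ * alpha n c N v := by
  rw [alpha_apply, alpha_apply, Finset.mul_sum, Finset.sum_mul, ← Equiv.sum_comp σ]
  refine Finset.sum_congr rfl fun i _ => ?_
  rw [mul_smul_comm, smul_mul_assoc, S_mul_alphaCoeff]
  simp [perm]

lemma euler_mul_yt_pow (i : Fin n) (k : ℕ) :
    euler n c * yt c i ^ k = yt c i ^ k * (euler n c - (k : ℂ) • (1 : Alg n c)) := by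
  have h := congrArg (fourier n c) (euler_mul_xt_pow (c := c) i k)
  simp only [map_mul, map_add, map_smul, map_one, map_pow, fourier_xt, fourier_euler] at h
  rw [← neg_inj, ← neg_mul, h, ← mul_neg]
  congr 1
  abel

/-- Under `ad 𝐡` each `x̃_i` has weight `1` and each `ỹ_i` weight `-1`, so all three forms of the
coefficient have weight `N`. -/
lemma euler_mul_alphaCoeff (N : ℤ) (i : Fin n) :
    euler n c * alphaCoeff c N i = alphaCoeff c N i * (euler n c + (N : ℂ) • (1 : Alg n c)) := by
  unfold alphaCoeff
  split_ifs with h h'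
  · have : (N : ℂ) = (N.natAbs : ℂ) := by
      rw [← Int.cast_natCast, Int.natAbs_of_nonneg h.le]
    rw [euler_mul_xt_pow, this]
  · subst h'
    rw [← mul_assoc, xt, euler_mul_X, yt, mul_assoc, add_mul, euler_mul_Y]
    simp only [mul_sub, mul_one, one_mul, sub_add_cancel, Int.cast_zero, zero_smul, add_zero,
      mul_assoc]
  · have : (N : ℂ) = -(N.natAbs : ℂ) := by
      rw [← Int.cast_natCast, Int.ofNat_natAbs_of_nonpos (by omega)]; simp
    rw [euler_mul_yt_pow, this, neg_smul, sub_eq_add_neg]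

lemma euler_mul_alpha (N : ℤ) (v : refl n) :
    euler n c * alpha n c N v = alpha n c N v * (euler n c + (N : ℂ) • (1 : Alg n c)) := by
  rw [alpha_apply, Finset.mul_sum, Finset.sum_mul]
  refine Finset.sum_congr rfl fun i _ => ?_
  rw [mul_smul_comm, smul_mul_assoc, euler_mul_alphaCoeff]

/-! ### The polynomial part of the filtration -/

/-- The span of `1`, `𝔥` and `𝔥*` in `𝐇_c`. -/
def lin (n : ℕ) (c : ℂ) : Submodule ℂ (Alg n c) :=
  1 ⊔ Submodule.span ℂ (Set.range (X c) ∪ Set.range (Y c))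

lemma X_mem_lin (v : refl n) : X c v ∈ lin n c :=
  Submodule.mem_sup_right (Submodule.subset_span (Or.inl ⟨v, rfl⟩))

lemma Y_mem_lin (v : refl n) : Y c v ∈ lin n c :=
  Submodule.mem_sup_right (Submodule.subset_span (Or.inr ⟨v, rfl⟩))

/-- Powers of `lin` are used in place of `𝒢` because they contain no group elements. Permutations
have degree zero without commuting with `x` and `y`, so commutators in `𝒢` need not drop degree. -/
lemma lin_pow_le_G (i : ℕ) : lin n c ^ i ≤ G n c i := by
  have h1 : (1 : Submodule ℂ (Alg n c)) ≤ Submodule.span ℂ (Set.range (S c)) :=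
    Submodule.one_le.2 (Submodule.subset_span ⟨1, S_one⟩)
  calc lin n c ^ i = 1 * (lin n c * 1) ^ i := by rw [one_mul, mul_one]
    _ ≤ _ := by
      unfold G lin
      gcongr

lemma alphaCoeff_mem (N : ℤ) (i : Fin n) : alphaCoeff c N i ∈ lin n c ^ wt N := by
  unfold alphaCoeff wt
  split_ifs with h h' h'
  · omega
  · rw [pow_two]; exact Submodule.mul_mem_mul (X_mem_lin _) (Y_mem_lin _)
  · exact Submodule.pow_mem_pow _ (X_mem_lin _) _
  · exact Submodule.pow_mem_pow _ (Y_mem_lin _) _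

lemma alpha_mem_lin_pow (N : ℤ) (v : refl n) : alpha n c N v ∈ lin n c ^ wt N := by
  rw [alpha_apply]
  exact Submodule.sum_mem _ fun i _ => Submodule.smul_mem _ _ (alphaCoeff_mem N i)

lemma wt_neg (N : ℤ) : wt (-N) = wt N := by
  simp [wt]

/-- For `N > 0` the sign is `1` by definition of `α_{-N}`. For `N < 0` it is `(-1)^|N|`, because `Φ`
sends `ỹ_i` to `-x̃_i`. -/
lemma fourier_alpha_of_ne {N : ℤ} (h : N ≠ 0) :
    ∃ ε : ℂ, (ε = 1 ∨ ε = -1) ∧ ∀ v : refl n, fourier n c (alpha n c N v) = ε • alpha n c (-N) v := by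
  rcases h.lt_or_gt with h | h
  · refine ⟨(-1) ^ N.natAbs, neg_one_pow_eq_or _ _, fun v => ?_⟩
    simp only [alpha_of_neg h, alpha_of_pos (neg_pos.2 h), ofCoeffs_apply, map_sum, map_smul,
      map_pow, fourier_yt, Int.natAbs_neg, Finset.smul_sum]
    refine Finset.sum_congr rfl fun i _ => ?_
    rw [smul_comm, ← neg_one_smul ℂ (xt c i), smul_pow]
  · refine ⟨1, Or.inl rfl, fun v => ?_⟩
    simp only [alpha_of_neg (neg_lt_zero.2 h), alpha_of_pos h, ofCoeffs_apply, map_sum, map_smul,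
      map_pow, fourier_xt, Int.natAbs_neg, one_smul]

lemma fourier_alpha_zero (v : refl n) :
    fourier n c (alpha n c 0 v) + alpha n c 0 v =
      ∑ i, v.1 i • (xt c i * yt c i - yt c i * xt c i) := by
  simp only [alpha_zero, ofCoeffs_apply, map_sum, map_smul, map_mul, fourier_xt, fourier_yt,
    ← Finset.sum_add_distrib, ← smul_add]
  refine Finset.sum_congr rfl fun i _ => ?_
  congr 1
  noncomm_ring

end Algebra

section Filtered

set_option linter.unusedSectionVars false

variable {n : ℕ} {c : ℂ} {L : Type*} [AddCommGroup L] [Module ℂ L] [Module (Alg n c) L]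
  [IsScalarTower ℂ (Alg n c) L]

lemma act_apply (a : Alg n c) (v : L) : act n c L a v = a • v := rfl

lemma act_mul (a b : Alg n c) : act n c L (a * b) = act n c L a * act n c L b :=
  map_mul (Algebra.lsmul ℂ ℂ L) a b

lemma act_add (a b : Alg n c) : act n c L (a + b) = act n c L a + act n c L b :=
  map_add (Algebra.lsmul ℂ ℂ L) a b

lemma act_sub (a b : Alg n c) : act n c L (a - b) = act n c L a - act n c L b :=
  map_sub (Algebra.lsmul ℂ ℂ L) a b

lemma act_smul (r : ℂ) (a : Alg n c) : act n c L (r • a) = r • act n c L a :=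
  map_smul (Algebra.lsmul ℂ ℂ L) r a

lemma act_one : act n c L 1 = 1 := map_one (Algebra.lsmul ℂ ℂ L)

/-! ### Operators shifting the filtration -/

/-- The operators on `L` which shift the filtration by `k`. -/
def shift (F : Filtr n c L) (k : ℤ) : Submodule ℂ (Module.End ℂ L) where
  carrier := {T | ∀ j, ∀ v ∈ F.F j, T v ∈ F.F (j + k)}
  add_mem' hS hT j v hv := Submodule.add_mem _ (hS j v hv) (hT j v hv)
  zero_mem' _ _ _ := Submodule.zero_mem _
  smul_mem' r _ hT j v hv := Submodule.smul_mem _ r (hT j v hv)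

variable {F : Filtr n c L}

lemma shift_apply {k : ℤ} {T : Module.End ℂ L} (hT : T ∈ shift F k) {j : ℤ} {v : L}
    (hv : v ∈ F.F j) : T v ∈ F.F (j + k) :=
  hT j v hv

variable (F)

lemma shift_mono {k l : ℤ} (h : k ≤ l) : shift F k ≤ shift F l :=
  fun _ hT j v hv => F.mono (by omega) (hT j v hv)

lemma mul_mem_shift {k l : ℤ} {S T : Module.End ℂ L} (hS : S ∈ shift F k) (hT : T ∈ shift F l) :
    S * T ∈ shift F (k + l) := fun j v hv => by
  have := hS _ _ (hT j v hv)
  rwa [add_assoc, add_comm l] at this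

lemma act_mem_shift {i : ℕ} {a : Alg n c} (ha : a ∈ G n c i) : act n c L a ∈ shift F i :=
  fun j v hv => F.smul_mem i j a v ha hv

lemma act_S_mem_shift (σ : Equiv.Perm (Fin n)) : act n c L (S c σ) ∈ shift F 0 :=
  act_mem_shift F (i := 0) (S_mem_G σ)

lemma act_one_mem_shift : act n c L 1 ∈ shift F 0 := by
  rw [act_one]
  intro j v hv
  simpa using hv

lemma act_lin_mem_shift {a : Alg n c} (ha : a ∈ lin n c) : act n c L a ∈ shift F 1 :=
  act_mem_shift F (i := 1) (lin_pow_le_G 1 (by simpa using ha))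

lemma act_lin_pow_mem_shift {i : ℕ} {a : Alg n c} (ha : a ∈ lin n c ^ i) :
    act n c L a ∈ shift F i :=
  act_mem_shift F (lin_pow_le_G i ha)

lemma act_alpha_mem_shift (N : ℤ) (v : refl n) : act n c L (alpha n c N v) ∈ shift F (wt N) :=
  act_lin_pow_mem_shift F (alpha_mem_lin_pow N v)

/-- The commutator is a combination of `1` and reflections, so its degree is `0` rather than `2`. -/
lemma act_YX_comm_mem_shift (v w : refl n) :
    act n c L (Y c v * X c w - X c w * Y c v) ∈ shift F 0 := by
  rw [Y_mul_X_sub, act_sub, act_smul, act_smul]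
  refine Submodule.sub_mem _ (Submodule.smul_mem _ _ (act_one_mem_shift F))
    (Submodule.smul_mem _ _ ?_)
  simp only [act, map_sum, map_smul]
  exact Submodule.sum_mem _ fun i _ => Submodule.sum_mem _ fun j _ =>
    Submodule.smul_mem _ _ (act_S_mem_shift F _)

lemma act_comm_lin_mem_shift {a b : Alg n c} (ha : a ∈ lin n c) (hb : b ∈ lin n c) :
    act n c L (a * b - b * a) ∈ shift F 0 := by
  let Br : Alg n c →ₗ[ℂ] Alg n c →ₗ[ℂ] Module.End ℂ L :=
    (LinearMap.mul ℂ (Alg n c) - (LinearMap.mul ℂ (Alg n c)).flip).compr₂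
      (Algebra.lsmul ℂ ℂ L).toLinearMap
  have hBr : ∀ a b, Br a b = act n c L (a * b - b * a) := fun a b => rfl
  have hlin : lin n c = Submodule.span ℂ ({1} ∪ (Set.range (X c) ∪ Set.range (Y c))) := by
    rw [Submodule.span_union, ← Submodule.one_eq_span]; rfl
  rw [← hBr]
  have key : ∀ a ∈ ({1} ∪ (Set.range (X c) ∪ Set.range (Y c)) : Set (Alg n c)),
      ∀ b ∈ ({1} ∪ (Set.range (X c) ∪ Set.range (Y c)) : Set (Alg n c)), Br a b ∈ shift F 0 := by
    have h0 : act n c L 0 ∈ shift F 0 := by simp [act]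
    rintro _ (rfl | ⟨v, rfl⟩ | ⟨v, rfl⟩) _ (rfl | ⟨w, rfl⟩ | ⟨w, rfl⟩) <;> rw [hBr]
    any_goals (simpa using h0)
    · rwa [X_comm, sub_self]
    · rw [← neg_sub, act, map_neg]
      exact Submodule.neg_mem _ (act_YX_comm_mem_shift F _ _)
    · exact act_YX_comm_mem_shift F _ _
    · rwa [Y_comm, sub_self]
  rw [hlin] at ha hb
  have h1 : ∀ a ∈ ({1} ∪ (Set.range (X c) ∪ Set.range (Y c)) : Set (Alg n c)),
      Br a b ∈ shift F 0 := fun a ha =>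
    (Submodule.span_le (p := (shift F 0).comap (Br a))).2 (fun b hb => key a ha b hb) hb
  exact (Submodule.span_le (p := (shift F 0).comap (Br.flip b))).2 (fun a ha => h1 a ha) ha

/-- Leibniz rule in the second factor. The bound `j = 1 + j - 1` records a drop by one, which is all
that vanishing on `gr L` needs. -/
lemma act_comm_lin_pow_mem_shift {a b : Alg n c} {j : ℕ} (ha : a ∈ lin n c)
    (hb : b ∈ lin n c ^ j) : act n c L (a * b - b * a) ∈ shift F j := by
  induction j generalizing b with
  | zero =>
    obtain ⟨r, rfl⟩ := Submodule.mem_one.1 (by simpa using hb)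
    rw [← Algebra.commutes, sub_self]
    simp [act]
  | succ j ih =>
    rw [pow_succ'] at hb
    refine Submodule.mul_induction_on hb (fun x hx y hy => ?_) (fun x y hx hy => ?_)
    · have : a * (x * y) - x * y * a = (a * x - x * a) * y + x * (a * y - y * a) := by
        noncomm_ring
      rw [this, act_add, act_mul, act_mul]
      refine Submodule.add_mem _ (shift_mono F ?_ (mul_mem_shift F (act_comm_lin_mem_shift F ha hx)
        (act_lin_pow_mem_shift F hy))) (shift_mono F ?_ (mul_mem_shift F (act_lin_mem_shift F hx)
        (ih hy))) <;> push_cast <;> omega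
    · have : a * (x + y) - (x + y) * a = (a * x - x * a) + (a * y - y * a) := by noncomm_ring
      rw [this, act_add]
      exact Submodule.add_mem _ hx hy

/-- Commutators of polynomials in `𝔥 ∪ 𝔥*` drop the filtration degree. -/
lemma act_comm_mem_shift {a b : Alg n c} {i j : ℕ} (ha : a ∈ lin n c ^ i)
    (hb : b ∈ lin n c ^ j) : act n c L (a * b - b * a) ∈ shift F (i + j - 1) := by
  induction i generalizing a with
  | zero =>
    obtain ⟨r, rfl⟩ := Submodule.mem_one.1 (by simpa using ha)
    rw [← Algebra.commutes, sub_self]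
    simp [act]
  | succ i ih =>
    rw [pow_succ'] at ha
    refine Submodule.mul_induction_on ha (fun x hx y hy => ?_) (fun x y hx hy => ?_)
    · have : x * y * b - b * (x * y) = x * (y * b - b * y) + (x * b - b * x) * y := by
        noncomm_ring
      rw [this, act_add, act_mul, act_mul]
      refine Submodule.add_mem _ (shift_mono F ?_ (mul_mem_shift F (act_lin_mem_shift F hx)
        (ih hy))) (shift_mono F ?_ (mul_mem_shift F (act_comm_lin_pow_mem_shift F hx hb)
        (act_lin_pow_mem_shift F hy))) <;> push_cast <;> omega
    · have : (x + y) * b - b * (x + y) = (x * b - b * x) + (y * b - b * y) := by noncomm_ring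
      rw [this, act_add]
      exact Submodule.add_mem _ hx hy

/-! ### Induced operators on the associated graded space -/

/-- Transport between summands whose indices, such as `j + 0` and `j`, are equal without being
definitionally equal. -/
lemma grClass_congr {i j : ℤ} {v w : L} (hij : i = j) (hvw : v = w) (hv : v ∈ F.F i)
    (hw : w ∈ F.F j) : grClass F i ⟨v, hv⟩ = grClass F j ⟨w, hw⟩ := by
  subst hij hvw; rfl

lemma grClass_eq_zero {j : ℤ} {v : L} (hv : v ∈ F.F j) (h : v ∈ F.F (j - 1)) :
    grClass F j ⟨v, hv⟩ = 0 := by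
  have : Submodule.Quotient.mk (p := (F.F (j - 1)).submoduleOf (F.F j)) ⟨v, hv⟩ = 0 :=
    (Submodule.Quotient.mk_eq_zero _).2 h
  simp [grClass, this]

lemma Gr.hom_ext {A B : Module.End ℂ (Gr F)}
    (h : ∀ (j : ℤ) (v : L) (hv : v ∈ F.F j), A (grClass F j ⟨v, hv⟩) = B (grClass F j ⟨v, hv⟩)) :
    A = B := by
  refine DirectSum.linearMap_ext ℂ fun j => ?_
  refine LinearMap.ext fun x => ?_
  obtain ⟨⟨v, hv⟩, rfl⟩ := Submodule.mkQ_surjective _ x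
  exact h j v hv

lemma grClass_eq_of_sub_mem {j : ℤ} {v w : L} (hv : v ∈ F.F j) (hw : w ∈ F.F j)
    (h : v - w ∈ F.F (j - 1)) : grClass F j ⟨v, hv⟩ = grClass F j ⟨w, hw⟩ := by
  have e := grClass_eq_zero F (Submodule.sub_mem _ hv hw) h
  have e' := map_sub (grClass F j) ⟨v, hv⟩ ⟨w, hw⟩
  exact sub_eq_zero.1 (e'.symm.trans e)

/-- The map `gr_j L → gr_{j+k} L` induced by an operator which shifts the filtration by `k`. -/
def grPartMap (k : ℤ) (T : Module.End ℂ L) (hT : T ∈ shift F k) (j : ℤ) :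
    GrPart F j →ₗ[ℂ] GrPart F (j + k) :=
  Submodule.mapQ _ _
    (LinearMap.restrict T (p := F.F j) (q := F.F (j + k)) fun _ hv => shift_apply hT hv)
    (fun v (hv : v.1 ∈ F.F (j - 1)) => by
      have := shift_apply hT hv
      rwa [show j - 1 + k = j + k - 1 by ring] at this)

/-- The operator on `gr L` induced by an operator which shifts the filtration by `k`. -/
def grMap (k : ℤ) (T : Module.End ℂ L) (hT : T ∈ shift F k) : Module.End ℂ (Gr F) :=
  DirectSum.toModule ℂ ℤ (Gr F) fun j =>
    (DirectSum.lof ℂ ℤ (GrPart F) (j + k)).comp (grPartMap F k T hT j)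

variable {F}

lemma grMap_grClass {k : ℤ} {T : Module.End ℂ L} (hT : T ∈ shift F k) {j : ℤ} {v : L}
    (hv : v ∈ F.F j) :
    grMap F k T hT (grClass F j ⟨v, hv⟩) = grClass F (j + k) ⟨T v, shift_apply hT hv⟩ :=
  DirectSum.toModule_lof (φ := fun j =>
    (DirectSum.lof ℂ ℤ (GrPart F) (j + k)).comp (grPartMap F k T hT j)) ℂ j _

lemma grPerm_eq (σ : Equiv.Perm (Fin n)) :
    grPerm F σ = grMap F 0 (act n c L (S c σ)) (act_S_mem_shift F σ) := by
  refine Gr.hom_ext F fun j v hv => ?_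
  rw [grMap_grClass]
  have : grPerm F σ (grClass F j ⟨v, hv⟩) =
      grClass F j ⟨act n c L (S c σ) v, act_S_mem F σ j v hv⟩ := by
    simp only [grPerm, grClass, LinearMap.comp_apply, DirectSum.lmap_lof]
    rfl
  rw [this]
  exact grClass_congr F (by simp) rfl _ _

lemma grPerm_grClass (σ : Equiv.Perm (Fin n)) {j : ℤ} {v : L} (hv : v ∈ F.F j) :
    grPerm F σ (grClass F j ⟨v, hv⟩) = grClass F j ⟨S c σ • v, act_S_mem F σ j v hv⟩ := by
  rw [grPerm_eq, grMap_grClass]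
  exact grClass_congr F (by simp) rfl _ _

/-- Two pairs of operators with equal compositions up to lower order induce equal compositions on
`gr L`. -/
lemma grMap_mul_eq {k l k' l' : ℤ} {A B A' B' : Module.End ℂ L} (hA : A ∈ shift F k)
    (hB : B ∈ shift F l) (hA' : A' ∈ shift F k') (hB' : B' ∈ shift F l') (h : k + l = k' + l')
    (hAB : A * B - A' * B' ∈ shift F (k + l - 1)) :
    grMap F k A hA * grMap F l B hB = grMap F k' A' hA' * grMap F l' B' hB' := by
  refine Gr.hom_ext F fun j v hv => ?_
  simp only [Module.End.mul_apply, grMap_grClass]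
  have e : j + l' + k' = j + l + k := by omega
  have m : A' (B' v) ∈ F.F (j + l + k) := e ▸ shift_apply hA' (shift_apply hB' hv)
  rw [grClass_congr F e rfl _ m]
  refine grClass_eq_of_sub_mem F _ m ?_
  have := shift_apply hAB hv
  rwa [show j + (k + l - 1) = j + l + k - 1 by omega] at this

/-- Only the leading term of an operator is visible on `gr L`; this is used to compare `Φ(α_N(v))`
with `±α_{-N}(v)`. -/
lemma grMap_smul {k l : ℤ} {A B : Module.End ℂ L} (r : ℂ) (hA : A ∈ shift F k)
    (hB : B ∈ shift F l) (hkl : k = l) (h : A - r • B ∈ shift F (k - 1)) :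
    grMap F k A hA = r • grMap F l B hB := by
  subst hkl
  refine Gr.hom_ext F fun j v hv => ?_
  rw [LinearMap.smul_apply, grMap_grClass, grMap_grClass, ← map_smul]
  refine grClass_eq_of_sub_mem F _ (Submodule.smul_mem _ r (shift_apply hB hv)) ?_
  have := shift_apply h hv
  rwa [← add_sub_assoc] at this

/-! ### The differentials -/

variable (F) in
/-- The operator by which `α_N(v)` acts on `gr L`. -/
def grAlpha (N : ℤ) (v : refl n) : Module.End ℂ (Gr F) :=
  grMap F (wt N) (act n c L (alpha n c N v)) (act_alpha_mem_shift F N v)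

lemma grPerm_mul_grAlpha (N : ℤ) (σ : Equiv.Perm (Fin n)) (v : refl n) :
    grPerm F σ * grAlpha F N v = grAlpha F N (perm σ v) * grPerm F σ := by
  rw [grPerm_eq, grAlpha, grAlpha]
  refine grMap_mul_eq _ _ _ _ (by ring) ?_
  rw [← act_mul, ← act_mul, alpha_perm, sub_self]
  exact Submodule.zero_mem _

lemma grAlpha_commute (M N : ℤ) (v w : refl n) :
    grAlpha F M v * grAlpha F N w = grAlpha F N w * grAlpha F M v := by
  refine grMap_mul_eq _ _ _ _ (by ring) ?_
  rw [← act_mul, ← act_mul, ← act_sub]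
  exact act_comm_mem_shift F (alpha_mem_lin_pow M v) (alpha_mem_lin_pow N w)

lemma extPerm_ι (σ : Equiv.Perm (Fin n)) (v : refl n) :
    extPerm σ (ExteriorAlgebra.ι ℂ v) = ExteriorAlgebra.ι ℂ (perm σ v) := by
  simp [extPerm]

variable (F) in
/-- The contraction of maps with values in `gr L` with `α_N`. -/
def grContract (N : ℤ) (ψ : Ext n →ₗ[ℂ] Gr F) : Ext n →ₗ[ℂ] Gr F :=
  ∑ i : Fin n, (grAlpha F N (proj i)).comp
    (ψ.comp (LinearMap.mulLeft ℂ (ExteriorAlgebra.ι ℂ (proj i))))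

lemma grContract_apply (N : ℤ) (ψ : Ext n →ₗ[ℂ] Gr F) (w : Ext n) :
    grContract F N ψ w =
      ∑ i, grAlpha F N (proj i) (ψ (ExteriorAlgebra.ι ℂ (proj i) * w)) := by
  simp [grContract]

/-- A permutation permutes the frame vectors `proj i`, so the tensor `∑ proj i ⊗ proj i` is
invariant and the sum can be reindexed. -/
lemma grContract_mem (N : ℤ) {ψ : Ext n →ₗ[ℂ] Gr F} (hψ : ψ ∈ H F) : grContract F N ψ ∈ H F := by
  intro σ w
  rw [grContract_apply, grContract_apply, map_sum, ← Equiv.sum_comp σ]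
  refine Finset.sum_congr rfl fun i _ => ?_
  rw [← perm_proj, ← extPerm_ι, ← map_mul, hψ σ, ← Module.End.mul_apply, ← grPerm_mul_grAlpha]
  rfl

variable (F) in
/-- The differential `d_N` on `H`. -/
def diff (N : ℤ) : Module.End ℂ (H F) where
  toFun ψ := ⟨grContract F N ψ.1, grContract_mem N ψ.2⟩
  map_add' a b := by
    apply Subtype.ext
    ext w
    simp [grContract_apply, Finset.sum_add_distrib]
  map_smul' r a := by
    apply Subtype.ext
    ext w
    simp [grContract_apply, Finset.smul_sum]

lemma diff_apply (N : ℤ) (ψ : H F) (w : Ext n) :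
    (diff F N ψ).1 w = ∑ i, grAlpha F N (proj i) (ψ.1 (ExteriorAlgebra.ι ℂ (proj i) * w)) :=
  grContract_apply N ψ.1 w

lemma isInduced_diff (N : ℤ) : IsInduced F (wt N) (contract (alpha n c N)) (diff F N) := by
  intro j φ ψ _ hφ w
  choose h hψ using hφ
  have e : contract (alpha n c N) φ w =
      ∑ i, act n c L (alpha n c N (proj i)) (φ (ExteriorAlgebra.ι ℂ (proj i) * w)) := by
    simp [contract]
  have m : ∀ i, act n c L (alpha n c N (proj i)) (φ (ExteriorAlgebra.ι ℂ (proj i) * w)) ∈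
      F.F (j + wt N) := fun i => act_alpha_mem_shift F N _ j _ (h _)
  refine ⟨e ▸ Submodule.sum_mem _ fun i _ => m i, ?_⟩
  have e' : (⟨contract (alpha n c N) φ w, e ▸ Submodule.sum_mem _ fun i _ => m i⟩ :
      F.F (j + wt N)) = ∑ i, ⟨_, m i⟩ := Subtype.ext (by simp [e])
  rw [e', map_sum, diff_apply]
  refine Finset.sum_congr rfl fun i _ => ?_
  rw [hψ, grAlpha, grMap_grClass]

/-- In the double sum over the frame, the operators `α_M(pᵢ)` and `α_N(pⱼ)` commute while `pᵢ ∧ pⱼ`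
is antisymmetric, so the terms of the two compositions cancel in pairs. -/
lemma diff_anticomm (M N : ℤ) : diff F M * diff F N + diff F N * diff F M = 0 := by
  refine LinearMap.ext fun ψ => Subtype.ext (LinearMap.ext fun w => ?_)
  change (diff F M (diff F N ψ)).1 w + (diff F N (diff F M ψ)).1 w = 0
  simp only [diff_apply, map_sum]
  rw [Finset.sum_comm, ← Finset.sum_add_distrib]
  refine Finset.sum_eq_zero fun i _ => ?_
  rw [← Finset.sum_add_distrib]
  refine Finset.sum_eq_zero fun j _ => ?_
  rw [← Module.End.mul_apply, ← Module.End.mul_apply, grAlpha_commute, ← map_add, ← map_add,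
    ← mul_assoc, ← mul_assoc, ← add_mul, ExteriorAlgebra.ι_add_mul_swap]
  simp

lemma diff_sq (N : ℤ) : diff F N * diff F N = 0 := by
  have := diff_anticomm (F := F) N N
  rwa [← two_smul ℂ, smul_eq_zero_iff_right two_ne_zero] at this

lemma grAlpha_mem_grPiece (N : ℤ) (v : refl n) {q f : ℤ} {x : Gr F} (hx : x ∈ grPiece F q f) :
    grAlpha F N v x ∈ grPiece F (q + 2 * N) (f + wt N) := by
  obtain ⟨⟨u, hu⟩, hq, rfl⟩ := hx
  have hq' : ((2 : ℂ) • euler n c) • u = (q : ℂ) • u := Module.End.mem_eigenspace_iff.1 hq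
  rw [smul_assoc] at hq'
  refine ⟨⟨_, act_alpha_mem_shift F N v f u hu⟩, Module.End.mem_eigenspace_iff.2 ?_, ?_⟩
  · change ((2 : ℂ) • euler n c) • (alpha n c N v • u) = ((q + 2 * N : ℤ) : ℂ) • (alpha n c N v • u)
    have sc : ∀ (a : Alg n c) (r : ℂ) (u : L), a • r • u = r • a • u := fun a r u =>
      map_smul (act n c L a) r u
    rw [smul_assoc, ← mul_smul, euler_mul_alpha, mul_smul, add_smul, smul_assoc, one_smul, ← sc,
      smul_add, hq', ← sc, smul_smul, ← add_smul]
    push_cast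
    rfl
  · rw [grAlpha, grMap_grClass]

lemma diff_mem_piece (N m a q f : ℤ) {ψ : H F} (hψ : ψ ∈ piece F m a q f) :
    diff F N ψ ∈ piece F m (a - 2) (q + 2 * N) (f + wt N) := by
  refine ⟨fun k hk w hw => ?_, fun w => ?_⟩
  · rw [diff_apply]
    refine Finset.sum_eq_zero fun i _ => ?_
    -- The value of `d_N ψ` on `Λ^k` involves `ψ` only on `Λ^(k+1)`, whence the shift of `a` by
    -- `-2`.
    rw [hψ.1 (k + 1) (by push_cast; intro h; apply hk; linarith), map_zero]
    rw [ExteriorAlgebra.exteriorPower, pow_succ']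
    exact Submodule.mul_mem_mul ⟨_, rfl⟩ hw
  · rw [diff_apply]
    exact Submodule.sum_mem _ fun i _ => grAlpha_mem_grPiece N _ (hψ.2 _)

/-! ### Lifting to equivariant maps -/

/-- Exterior powers above the dimension of `𝔥` vanish. Finiteness ensures that a map from `Λ*𝔥` to
the infinite direct sum `gr L` has only finitely many nonzero homogeneous components. -/
instance finite_ext : Module.Finite ℂ (Ext n) := by
  have hz : ∀ k, Module.finrank ℂ (refl n) < k → ⋀[ℂ]^k (refl n) = ⊥ := fun k hk => by
    have : Module.finrank ℂ (⋀[ℂ]^k (refl n)) = 0 := by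
      rw [exteriorPower.finrank_eq, Nat.choose_eq_zero_of_lt hk]
    exact Submodule.finrank_eq_zero.1 this
  have h := (DirectSum.Decomposition.isInternal
    (fun k : ℕ => ⋀[ℂ]^k (refl n))).submodule_iSup_eq_top
  have h' : ⨆ k : Fin (Module.finrank ℂ (refl n) + 1), ⋀[ℂ]^(k : ℕ) (refl n) = ⊤ := by
    rw [eq_top_iff, ← h]
    refine iSup_le fun k => ?_
    by_cases hk : Module.finrank ℂ (refl n) < k
    · simp [hz k hk]
    · exact le_iSup (fun k : Fin (Module.finrank ℂ (refl n) + 1) => ⋀[ℂ]^(k : ℕ) (refl n))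
        ⟨k, by omega⟩
  rw [Module.finite_def, ← h']
  exact Submodule.fg_iSup _ fun k => Module.finite_def.1 inferInstance |> fun h =>
    (Submodule.fg_top _).1 h

variable (F) in
/-- The projection of `gr L` to its `j`-th summand. -/
def grProj (j : ℤ) : Module.End ℂ (Gr F) :=
  (DirectSum.lof ℂ ℤ (GrPart F) j).comp (DirectSum.component ℂ ℤ (GrPart F) j)

lemma grProj_grPerm (j : ℤ) (σ : Equiv.Perm (Fin n)) (x : Gr F) :
    grProj F j (grPerm F σ x) = grPerm F σ (grProj F j x) := by
  suffices h : (grProj F j).comp (grPerm F σ) = (grPerm F σ).comp (grProj F j) from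
    LinearMap.congr_fun h x
  refine DirectSum.linearMap_ext ℂ fun k => LinearMap.ext fun y => ?_
  simp only [grProj, grPerm, LinearMap.comp_apply, DirectSum.lmap_lof]
  by_cases h : k = j
  · subst h
    simp [DirectSum.component.lof_self]
  · simp [DirectSum.component.of, h]

variable (F) in
/-- The `j`-th homogeneous component of an element of `H`. -/
def Hproj (j : ℤ) (ψ : H F) : H F :=
  ⟨(grProj F j).comp ψ.1, fun σ w => by simp [ψ.2 σ w, grProj_grPerm]⟩

lemma exists_sum_Hproj (ψ : H F) : ∃ s : Finset ℤ, ψ = ∑ j ∈ s, Hproj F j ψ := by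
  classical
  obtain ⟨t, ht⟩ := (Module.finite_def.1 (finite_ext (n := n)))
  refine ⟨t.biUnion fun w => DFinsupp.support (ψ.1 w), Subtype.ext ?_⟩
  refine LinearMap.ext_on ht fun w hw => ?_
  rw [AddSubmonoidClass.coe_finsetSum, LinearMap.sum_apply]
  conv_lhs => rw [← DirectSum.sum_support_of (ψ.1 w)]
  refine Finset.sum_subset (Finset.subset_biUnion_of_mem (fun w => DFinsupp.support (ψ.1 w)) hw)
    fun j _ hj => ?_
  rw [DFinsupp.notMem_support_iff.1 hj, map_zero]

lemma exists_isClass (j : ℤ) (ψ : H F) :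
    ∃ φ : Ext n →ₗ[ℂ] L, IsEquivariant (c := c) φ ∧ IsClass F j φ (Hproj F j ψ) := by
  obtain ⟨s, hs⟩ := ((F.F (j - 1)).submoduleOf (F.F j)).mkQ.exists_rightInverse_of_surjective
    (Submodule.range_mkQ _)
  let φ₀ : Ext n →ₗ[ℂ] F.F j := s.comp ((DirectSum.component ℂ ℤ (GrPart F) j).comp ψ.1)
  have h₀ : ∀ w, grClass F j (φ₀ w) = (Hproj F j ψ).1 w := fun w => by
    have := LinearMap.congr_fun hs (DirectSum.component ℂ ℤ (GrPart F) j (ψ.1 w))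
    simp only [grClass, φ₀, Hproj, grProj, LinearMap.comp_apply]
    exact congrArg _ this
  let r : ℂ := (Fintype.card (Equiv.Perm (Fin n)) : ℂ)⁻¹
  have hr : r * (Fintype.card (Equiv.Perm (Fin n)) : ℂ) = 1 :=
    inv_mul_cancel₀ (by exact_mod_cast Fintype.card_ne_zero)
  -- Average the linear lift `φ₀` over `S_n`, with `r = 1/n!`, to make it equivariant.
  let φ : Ext n →ₗ[ℂ] L := r • ∑ σ : Equiv.Perm (Fin n), (act n c L (S c σ)).comp
    ((F.F j).subtype.comp (φ₀.comp (extPerm σ⁻¹).toLinearMap))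
  have hφ : ∀ w, φ w = r • ∑ σ : Equiv.Perm (Fin n), S c σ • (φ₀ (extPerm σ⁻¹ w) : L) := fun w => by
    simp [φ, act_apply]
  have hext : ∀ (σ τ : Equiv.Perm (Fin n)) (w : Ext n),
      extPerm σ (extPerm τ w) = extPerm (σ * τ) w := fun σ τ w => by
    have : (extPerm σ).comp (extPerm τ) = extPerm (σ * τ) := by
      ext v
      simp only [AlgHom.toLinearMap_apply, LinearMap.comp_apply, AlgHom.comp_apply, extPerm_ι]
      rfl
    exact DFunLike.congr_fun this w
  have hext1 : ∀ w : Ext n, extPerm 1 w = w := fun w => by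
    have : extPerm (1 : Equiv.Perm (Fin n)) = AlgHom.id ℂ (Ext n) := by
      ext v
      simp only [AlgHom.toLinearMap_apply, LinearMap.comp_apply, AlgHom.id_apply, extPerm_ι]
      rfl
    exact DFunLike.congr_fun this w
  refine ⟨φ, fun τ w => ?_, fun w => ?_⟩
  · have sc : ∀ (a : Alg n c) (r : ℂ) (u : L), a • r • u = r • a • u := fun a r u =>
      map_smul (act n c L a) r u
    rw [hφ, hφ, sc, Finset.smul_sum (r := S c τ), ← Equiv.sum_comp (Equiv.mulLeft τ)]
    refine congrArg (fun u : L => r • u) (Finset.sum_congr rfl fun σ _ => ?_)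
    rw [hext, ← mul_smul, ← S_mul]
    simp
  · have m : ∀ σ : Equiv.Perm (Fin n), S c σ • (φ₀ (extPerm σ⁻¹ w) : L) ∈ F.F j := fun σ =>
      act_S_mem F σ j _ (φ₀ _).2
    have e : φ w ∈ F.F j := hφ w ▸ Submodule.smul_mem _ _ (Submodule.sum_mem _ fun σ _ => m σ)
    refine ⟨e, ?_⟩
    have e' : (⟨φ w, e⟩ : F.F j) = r •
        ∑ σ : Equiv.Perm (Fin n), ⟨S c σ • (φ₀ (extPerm σ⁻¹ w) : L), m σ⟩ :=
      Subtype.ext (by simp [hφ])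
    rw [e', map_smul, map_sum]
    -- Averaging does not change the class: `ψ` is already equivariant, so all `n!` summands have
    -- the same class.
    have : ∀ σ : Equiv.Perm (Fin n),
        grClass F j ⟨S c σ • (φ₀ (extPerm σ⁻¹ w) : L), m σ⟩ = (Hproj F j ψ).1 w := fun σ => by
      rw [← grPerm_grClass σ (φ₀ (extPerm σ⁻¹ w)).2, h₀, ← (Hproj F j ψ).2 σ, hext, mul_inv_cancel,
        hext1]
    simp only [this, Finset.sum_const, Finset.card_univ]
    rw [← Nat.cast_smul_eq_nsmul ℂ, smul_smul, hr, one_smul]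

/-- A map on `H` induced by a map of `Hom(Λ*𝔥, L)` is determined by the latter. -/
lemma IsInduced.unique {i : ℕ} {del : (Ext n →ₗ[ℂ] L) → (Ext n →ₗ[ℂ] L)} {d e : Module.End ℂ (H F)}
    (hd : IsInduced F i del d) (he : IsInduced F i del e) : e = d := by
  refine LinearMap.ext fun ψ => ?_
  obtain ⟨s, hs⟩ := exists_sum_Hproj ψ
  rw [hs, map_sum, map_sum]
  refine Finset.sum_congr rfl fun j _ => Subtype.ext (LinearMap.ext fun w => ?_)
  obtain ⟨φ, h1, h2⟩ := exists_isClass j ψ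
  obtain ⟨_, h3⟩ := hd j φ _ h1 h2 w
  obtain ⟨_, h4⟩ := he j φ _ h1 h2 w
  rw [h3, h4]

end Filtered

/-! ### Exponentials of nilpotent operators -/

section Exp

variable {L : Type*} [AddCommGroup L] [Module ℂ L]

/-- Here `ad T` sends `a` to `b` and kills `b`, so only the first-order term of the expansion
survives. -/
lemma pow_succ_mul_of_commutator {A : Type*} [Ring A] {T a b : A} (h : T * a = a * T + b)
    (hb : T * b = b * T) (k : ℕ) :
    T ^ (k + 1) * a = a * T ^ (k + 1) + (k + 1) • (b * T ^ k) := by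
  induction k with
  | zero => simp [h]
  | succ k ih =>
    have hbk : T * (b * T ^ k) = b * T ^ (k + 1) := by
      rw [← mul_assoc, hb, mul_assoc, ← pow_succ']
    rw [pow_succ' T (k + 1), mul_assoc, ih, mul_add, ← mul_assoc, h, mul_smul_comm, hbk, add_mul,
      mul_assoc, succ_nsmul _ (k + 1)]
    abel

/-- Any exponent annihilating `T` may serve as cut-off, and the rational coefficients become complex
ones. -/
lemma expEnd_eq_sum {T : Module.End ℂ L} {k : ℕ} (h : T ^ k = 0) :
    expEnd L T = ∑ i ∈ Finset.range k, (i.factorial : ℂ)⁻¹ • T ^ i := by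
  let _ : Module ℚ (Module.End ℂ L) := Module.compHom _ (algebraMap ℚ ℂ)
  refine (IsNilpotent.exp_eq_sum h).trans (Finset.sum_congr rfl fun i _ => ?_)
  change algebraMap ℚ ℂ (i.factorial : ℚ)⁻¹ • T ^ i = _
  simp

lemma isUnit_expEnd {T : Module.End ℂ L} (h : IsNilpotent T) : IsUnit (expEnd L T) :=
  let _ : Module ℚ (Module.End ℂ L) := Module.compHom _ (algebraMap ℚ ℂ)
  IsNilpotent.isUnit_exp h

lemma expEnd_mul_of_commutator {T a b : Module.End ℂ L} (hT : IsNilpotent T)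
    (h : T * a = a * T + b) (hb : T * b = b * T) : expEnd L T * a = (a + b) * expEnd L T := by
  obtain ⟨k, hk⟩ := hT
  -- One extra power: the commutator lowers exponents by one, so the remaining sum over `range k` is
  -- again the full exponential.
  have hk' : T ^ (k + 1) = 0 := by rw [pow_succ, hk, zero_mul]
  have h1 : expEnd L T * a = a * expEnd L T + b * ∑ i ∈ Finset.range k,
      (i.factorial : ℂ)⁻¹ • T ^ i := by
    rw [expEnd_eq_sum hk', Finset.sum_range_succ']
    simp only [add_mul, mul_add, Finset.sum_mul, Finset.mul_sum, smul_mul_assoc, mul_smul_comm,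
      pow_succ_mul_of_commutator h hb, smul_add, Finset.sum_add_distrib, pow_zero, one_mul, mul_one]
    have : ∀ i ∈ Finset.range k, ((i + 1).factorial : ℂ)⁻¹ • (i + 1) • (b * T ^ i) =
        (i.factorial : ℂ)⁻¹ • (b * T ^ i) := fun i _ => by
      rw [← Nat.cast_smul_eq_nsmul ℂ, smul_smul, Nat.factorial_succ]
      congr 1
      push_cast
      have : (i : ℂ) + 1 ≠ 0 := by exact_mod_cast i.succ_ne_zero
      field_simp
    rw [Finset.sum_congr rfl this]
    abel
  rw [h1, ← expEnd_eq_sum hk, add_mul]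

lemma expEnd_mul_of_commute {T a : Module.End ℂ L} (hT : IsNilpotent T) (h : T * a = a * T) :
    expEnd L T * a = a * expEnd L T := by
  simpa using expEnd_mul_of_commutator (b := 0) hT (by simpa using h) (by simp)

lemma expEnd_mem {T : Module.End ℂ L} (hT : IsNilpotent T) {p : Submodule ℂ L}
    (hp : ∀ v ∈ p, T v ∈ p) {v : L} (hv : v ∈ p) : expEnd L T v ∈ p := by
  obtain ⟨k, hk⟩ := hT
  rw [expEnd_eq_sum hk, LinearMap.sum_apply]
  refine Submodule.sum_mem _ fun i hi => Submodule.smul_mem _ _ ?_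
  clear hi
  induction i with
  | zero => simpa using hv
  | succ i ih =>
    rw [pow_succ', Module.End.mul_apply]
    exact hp _ ih

/-- An operator on a finite-dimensional space which shifts the eigenvalues of another operator by a
nonzero number is nilpotent. -/
lemma isNilpotent_of_shift [FiniteDimensional ℂ L] {D T : Module.End ℂ L} {r : ℂ} (hr : r ≠ 0)
    (h : D * T = T * (D + r • (1 : Module.End ℂ L))) : IsNilpotent T := by
  by_contra hT
  have hT' : ∀ k, T ^ k ≠ 0 := fun k hk => hT ⟨k, hk⟩
  have hk : ∀ k : ℕ, D * T ^ k = T ^ k * (D + ((k : ℂ) * r) • (1 : Module.End ℂ L)) := by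
    intro k
    induction k with
    | zero => simp
    | succ k ih =>
      rw [pow_succ, ← mul_assoc, ih, mul_assoc, add_mul, h, mul_assoc]
      simp only [smul_mul_assoc, one_mul, mul_add, mul_one, mul_smul_comm, Nat.cast_succ, add_smul,
        add_mul]
      abel
  -- If no power of `T` vanished, the `T ^ k` would be eigenvectors of `ad D` with distinct
  -- eigenvalues `k r`, hence infinitely many independent vectors in the finite-dimensional space
  -- `End L`.
  have li := Module.End.eigenvectors_linearIndependent'
    (LinearMap.mulLeft ℂ D - LinearMap.mulRight ℂ D : Module.End ℂ (Module.End ℂ L))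
    (fun k : ℕ => (k : ℂ) * r)
    (fun a b hab => by exact_mod_cast mul_right_cancel₀ hr hab) (fun k : ℕ => T ^ k)
    fun k => ⟨Module.End.mem_eigenspace_iff.2 (by simp [hk, mul_add]), hT' k⟩
  exact not_finite_iff_infinite.2 (inferInstance : Infinite ℕ) li.finite

end Exp

section Fourier

variable {n : ℕ} {c : ℂ} {L : Type*} [AddCommGroup L] [Module ℂ L] [Module (Alg n c) L]
  [IsScalarTower ℂ (Alg n c) L]

/-! ### The Fourier transform -/

section FiniteDim

set_option linter.unusedSectionVars false

variable [FiniteDimensional ℂ L]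

lemma isNilpotent_half_xsq : IsNilpotent (act n c L ((1 / 2 : ℂ) • xsq n c)) := by
  refine isNilpotent_of_shift (D := act n c L (euler n c)) (r := 2) two_ne_zero ?_
  rw [← act_one (n := n) (c := c), ← act_smul, ← act_add, ← act_mul, ← act_mul, mul_smul_comm, euler_mul_xsq,
    smul_mul_assoc]

lemma isNilpotent_half_ysq : IsNilpotent (act n c L ((1 / 2 : ℂ) • ysq n c)) := by
  refine isNilpotent_of_shift (D := act n c L (euler n c)) (r := -2) (by norm_num) ?_
  rw [← act_one (n := n) (c := c), ← act_smul, ← act_add, ← act_mul, ← act_mul, mul_smul_comm, euler_mul_ysq,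
    smul_mul_assoc]

lemma isUnit_fourierMod : IsUnit (fourierMod n c L) :=
  ((isUnit_expEnd isNilpotent_half_xsq).mul (isUnit_expEnd isNilpotent_half_ysq)).mul
    (isUnit_expEnd isNilpotent_half_xsq)

lemma bijective_fourierMod : Function.Bijective (fourierMod n c L) :=
  (Module.End.isUnit_iff _).1 isUnit_fourierMod

lemma exp_xsq_mul_X (v : refl n) :
    expEnd L (act n c L ((1 / 2 : ℂ) • xsq n c)) * act n c L (X c v) =
      act n c L (X c v) * expEnd L (act n c L ((1 / 2 : ℂ) • xsq n c)) := by
  refine expEnd_mul_of_commute isNilpotent_half_xsq ?_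
  rw [← act_mul, ← act_mul, smul_mul_assoc, mul_smul_comm, xsq_mul_X]

lemma exp_ysq_mul_Y (v : refl n) :
    expEnd L (act n c L ((1 / 2 : ℂ) • ysq n c)) * act n c L (Y c v) =
      act n c L (Y c v) * expEnd L (act n c L ((1 / 2 : ℂ) • ysq n c)) := by
  refine expEnd_mul_of_commute isNilpotent_half_ysq ?_
  rw [← act_mul, ← act_mul, smul_mul_assoc, mul_smul_comm, ysq_mul_Y]

lemma exp_xsq_mul_Y (v : refl n) :
    expEnd L (act n c L ((1 / 2 : ℂ) • xsq n c)) * act n c L (Y c v) =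
      (act n c L (Y c v) - act n c L (X c v)) *
        expEnd L (act n c L ((1 / 2 : ℂ) • xsq n c)) := by
  rw [sub_eq_add_neg]
  refine expEnd_mul_of_commutator isNilpotent_half_xsq ?_ ?_
  · rw [← act_mul, ← act_mul, ← sub_eq_add_neg, ← act_sub, smul_mul_assoc, mul_smul_comm,
      xsq_mul_Y, smul_sub, smul_smul]
    norm_num
  · rw [mul_neg, neg_mul, ← act_mul, ← act_mul, smul_mul_assoc, mul_smul_comm, xsq_mul_X]

lemma exp_ysq_mul_X (v : refl n) :
    expEnd L (act n c L ((1 / 2 : ℂ) • ysq n c)) * act n c L (X c v) =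
      (act n c L (X c v) + act n c L (Y c v)) *
        expEnd L (act n c L ((1 / 2 : ℂ) • ysq n c)) := by
  refine expEnd_mul_of_commutator isNilpotent_half_ysq ?_ ?_
  · rw [← act_mul, ← act_mul, ← act_add, smul_mul_assoc, mul_smul_comm,
      ysq_mul_X, smul_add, smul_smul]
    norm_num
  · rw [← act_mul, ← act_mul, smul_mul_assoc, mul_smul_comm, ysq_mul_Y]

/-- Moving past the three exponentials from right to left: `X ↦ X ↦ X + Y ↦ X + (Y - X) = Y`. -/
lemma fourierMod_mul_X (v : refl n) :
    fourierMod n c L * act n c L (X c v) = act n c L (Y c v) * fourierMod n c L := by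
  rw [fourierMod, mul_assoc, exp_xsq_mul_X, ← mul_assoc, mul_assoc _ _ (act n c L (X c v)),
    exp_ysq_mul_X, ← mul_assoc, mul_add, exp_xsq_mul_X, exp_xsq_mul_Y, ← add_mul]
  noncomm_ring

/-- Here the chain is `Y ↦ Y - X ↦ Y - (X + Y) = -X ↦ -X`. -/
lemma fourierMod_mul_Y (v : refl n) :
    fourierMod n c L * act n c L (Y c v) = -act n c L (X c v) * fourierMod n c L := by
  rw [fourierMod, mul_assoc, exp_xsq_mul_Y, ← mul_assoc, mul_assoc _ _ (_ - _),
    mul_sub, exp_ysq_mul_Y, exp_ysq_mul_X, ← sub_mul, sub_add_cancel_right, ← mul_assoc, mul_neg,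
    exp_xsq_mul_X]
  noncomm_ring

lemma fourierMod_mul_S (σ : Equiv.Perm (Fin n)) :
    fourierMod n c L * act n c L (S c σ) = act n c L (S c σ) * fourierMod n c L := by
  have hx : expEnd L (act n c L ((1 / 2 : ℂ) • xsq n c)) * act n c L (S c σ) =
      act n c L (S c σ) * expEnd L (act n c L ((1 / 2 : ℂ) • xsq n c)) := by
    refine expEnd_mul_of_commute isNilpotent_half_xsq ?_
    rw [← act_mul, ← act_mul, smul_mul_assoc, mul_smul_comm, S_mul_xsq]
  have hy : expEnd L (act n c L ((1 / 2 : ℂ) • ysq n c)) * act n c L (S c σ) =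
      act n c L (S c σ) * expEnd L (act n c L ((1 / 2 : ℂ) • ysq n c)) := by
    refine expEnd_mul_of_commute isNilpotent_half_ysq ?_
    rw [← act_mul, ← act_mul, smul_mul_assoc, mul_smul_comm, S_mul_ysq]
  have hx' : Commute (expEnd L (act n c L ((1 / 2 : ℂ) • xsq n c))) (act n c L (S c σ)) := hx
  exact (hx'.mul_left hy).mul_left hx

lemma fourierMod_mul_act (a : Alg n c) :
    fourierMod n c L * act n c L a = act n c L (fourier n c a) * fourierMod n c L := by
  induction a using Alg.induction with
  | scalar r =>
    rw [AlgHom.commutes, Algebra.algebraMap_eq_smul_one, act_smul, act_one]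
    simp
  | hX v => rw [fourierMod_mul_X, fourier_X]
  | hY v =>
    rw [fourierMod_mul_Y, fourier_Y]
    simp [act]
  | hS σ => rw [fourierMod_mul_S, fourier_S]
  | mul a b ha hb => rw [map_mul, act_mul, act_mul, ← mul_assoc, ha, mul_assoc, hb, mul_assoc]
  | add a b ha hb => rw [map_add, act_add, act_add, mul_add, add_mul, ha, hb]

lemma fourierMod_smul (a : Alg n c) (p : L) :
    fourierMod n c L (a • p) = fourier n c a • fourierMod n c L p :=
  LinearMap.congr_fun (fourierMod_mul_act a) p

/-- Each exponential is a polynomial in `𝐱²` or `𝐲²`, and both preserve every `F_j`. -/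
lemma fourierMod_mem_shift {F : Filtr n c L} (hF : F.Sl2Stable) :
    fourierMod n c L ∈ shift F 0 := by
  intro j v hv
  rw [add_zero]
  have hx : ∀ v ∈ F.F j, act n c L ((1 / 2 : ℂ) • xsq n c) v ∈ F.F j := fun v hv => by
    rw [act_smul]
    exact Submodule.smul_mem _ _ (hF j v hv).1
  have hy : ∀ v ∈ F.F j, act n c L ((1 / 2 : ℂ) • ysq n c) v ∈ F.F j := fun v hv => by
    rw [act_smul]
    exact Submodule.smul_mem _ _ (hF j v hv).2
  exact expEnd_mem isNilpotent_half_xsq hx (expEnd_mem isNilpotent_half_ysq hy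
    (expEnd_mem isNilpotent_half_xsq hx hv))

/-- The inverse of a filtered bijection of a finite-dimensional space is filtered. -/
lemma mem_shift_zero_of_mul_eq_one {F : Filtr n c L} {T U : Module.End ℂ L} (hT : T ∈ shift F 0)
    (hUT : U * T = 1) : U ∈ shift F 0 := by
  intro j v hv
  rw [add_zero]
  have hT' : ∀ v ∈ F.F j, T v ∈ F.F j := fun v hv => by simpa using hT j v hv
  have hl : Function.LeftInverse U T := fun v => LinearMap.congr_fun hUT v
  have inj : Function.Injective (T.restrict hT') := fun a b hab =>
    Subtype.ext (hl.injective (congrArg Subtype.val hab))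
  -- An injective endomorphism of the finite-dimensional space `F_j` is onto, so `v` already has its
  -- preimage inside `F_j`.
  obtain ⟨w, hw⟩ := LinearMap.surjective_of_injective inj ⟨v, hv⟩
  have : T w.1 = v := congrArg Subtype.val hw
  rw [← this, hl w.1]
  exact w.2

end FiniteDim

/-! ### Equivariant automorphisms and `H` -/

variable {F : Filtr n c L}

lemma grMap_mul_eq_one {T U : Module.End ℂ L} (hT : T ∈ shift F 0) (hU : U ∈ shift F 0)
    (h : T * U = 1) : grMap F 0 T hT * grMap F 0 U hU = 1 := by
  refine Gr.hom_ext F fun j v hv => ?_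
  rw [Module.End.mul_apply, grMap_grClass, grMap_grClass]
  exact grClass_congr F (by simp) (LinearMap.congr_fun h v) _ _

variable (F) in
/-- The operator on `H` induced by a filtered equivariant operator on `L`. -/
def Hmap (T : Module.End ℂ L) (hT : T ∈ shift F 0)
    (hS : ∀ σ, T * act n c L (S c σ) = act n c L (S c σ) * T) : Module.End ℂ (H F) where
  toFun ψ := ⟨(grMap F 0 T hT).comp ψ.1, fun σ w => by
    rw [LinearMap.comp_apply, LinearMap.comp_apply, ψ.2 σ w, grPerm_eq, ← Module.End.mul_apply,
      ← Module.End.mul_apply, grMap_mul_eq hT (act_S_mem_shift F σ) (act_S_mem_shift F σ) hT rfl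
        (by rw [hS, sub_self]; exact Submodule.zero_mem _)]⟩
  map_add' a b := Subtype.ext (LinearMap.ext fun w => by simp)
  map_smul' r a := Subtype.ext (LinearMap.ext fun w => by simp)

lemma Hmap_apply {T : Module.End ℂ L} (hT : T ∈ shift F 0)
    (hS : ∀ σ, T * act n c L (S c σ) = act n c L (S c σ) * T) (ψ : H F) (w : Ext n) :
    (Hmap F T hT hS ψ).1 w = grMap F 0 T hT (ψ.1 w) := rfl

lemma Hmap_mul_eq_one {T U : Module.End ℂ L} (hT : T ∈ shift F 0) (hU : U ∈ shift F 0)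
    (hTS : ∀ σ, T * act n c L (S c σ) = act n c L (S c σ) * T)
    (hUS : ∀ σ, U * act n c L (S c σ) = act n c L (S c σ) * U) (h : T * U = 1) :
    (Hmap F T hT hTS).comp (Hmap F U hU hUS) = LinearMap.id := by
  refine LinearMap.ext fun ψ => Subtype.ext (LinearMap.ext fun w => ?_)
  exact LinearMap.congr_fun (grMap_mul_eq_one hT hU h) (ψ.1 w)

lemma isInduced_Hmap {T : Module.End ℂ L} (hT : T ∈ shift F 0)
    (hS : ∀ σ, T * act n c L (S c σ) = act n c L (S c σ) * T) :
    IsInduced F 0 (fun φ => T.comp φ) (Hmap F T hT hS) := by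
  intro j φ ψ _ hφ w
  obtain ⟨h, hψ⟩ := hφ w
  exact ⟨hT j _ h, by rw [Hmap_apply, hψ, grMap_grClass]; rfl⟩

/-- `Φ(α_N(v))` and `±α_{-N}(v)` agree up to lower order. -/
lemma fourier_alpha_sub_mem_shift (N : ℤ) : ∃ ε : ℂ, (ε = 1 ∨ ε = -1) ∧ ∀ v : refl n,
    act n c L (fourier n c (alpha n c N v)) - ε • act n c L (alpha n c (-N) v) ∈
      shift F (wt N - 1) := by
  by_cases hN : N = 0
  · subst hN
    refine ⟨-1, Or.inr rfl, fun v => ?_⟩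
    rw [neg_zero, neg_one_smul, sub_neg_eq_add, ← act_add, fourier_alpha_zero]
    -- The commutator has degree `0`, and `wt 0 - 1 = 1` leaves room to spare.
    have h : ∀ i, act n c L (xt c i * yt c i - yt c i * xt c i) ∈ shift F (wt 0 - 1) := fun i => by
      rw [← neg_sub (yt c i * xt c i), act, map_neg]
      exact Submodule.neg_mem _ (shift_mono F (by simp [wt]) (act_YX_comm_mem_shift F _ _))
    simp only [act, map_sum, map_smul] at h ⊢
    exact Submodule.sum_mem _ fun i _ => Submodule.smul_mem _ _ (h i)
  · obtain ⟨ε, hε, h⟩ := fourier_alpha_of_ne (n := n) (c := c) hN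
    refine ⟨ε, hε, fun v => ?_⟩
    rw [h, act_smul, sub_self]
    exact Submodule.zero_mem _

/-- An equivariant automorphism which intertwines the Fourier transform exchanges `d_N` and
`d_{-N}` up to sign. -/
lemma Hmap_diff {T : Module.End ℂ L} (hT : T ∈ shift F 0)
    (hS : ∀ σ, T * act n c L (S c σ) = act n c L (S c σ) * T)
    (hΦ : ∀ a, T * act n c L a = act n c L (fourier n c a) * T) (N : ℤ) :
    ∃ ε : ℂ, (ε = 1 ∨ ε = -1) ∧
      ∀ ψ : H F, Hmap F T hT hS (diff F N ψ) = ε • diff F (-N) (Hmap F T hT hS ψ) := by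
  obtain ⟨ε, hε, h⟩ := fourier_alpha_sub_mem_shift (F := F) N
  refine ⟨ε, hε, fun ψ => Subtype.ext (LinearMap.ext fun w => ?_)⟩
  have hw : (wt N : ℤ) = wt (-N) := by rw [wt_neg]
  have hneg : ∀ v, act n c L (alpha n c (-N) v) ∈ shift F (wt N) := fun v => by
    rw [hw]
    exact act_alpha_mem_shift F (-N) v
  have hm : ∀ v, act n c L (fourier n c (alpha n c N v)) ∈ shift F (wt N) := fun v => by
    have := Submodule.add_mem _ (shift_mono F (by omega) (h v)) (Submodule.smul_mem _ ε (hneg v))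
    rwa [sub_add_cancel] at this
  -- On `L` one has `T α_N(v) = Φ(α_N(v)) T`; on `gr L` the factor `Φ(α_N(v))` becomes `ε
  -- α_{-N}(v)`.
  have key : ∀ v, grMap F 0 T hT * grAlpha F N v = ε • (grAlpha F (-N) v * grMap F 0 T hT) :=
    fun v => by
      rw [← smul_mul_assoc, grAlpha, grAlpha, ← grMap_smul ε (hm v) _ hw (h v)]
      refine grMap_mul_eq _ _ _ _ (by ring) ?_
      rw [hΦ, sub_self]
      exact Submodule.zero_mem _
  change (Hmap F T hT hS (diff F N ψ)).1 w = ε • (diff F (-N) (Hmap F T hT hS ψ)).1 w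
  rw [Hmap_apply, diff_apply, diff_apply, map_sum, Finset.smul_sum]
  refine Finset.sum_congr rfl fun i _ => ?_
  rw [Hmap_apply, ← Module.End.mul_apply, key]
  rfl

end Fourier

end Cherednik

end

/-! ### Assembly of the theorem. -/

open Cherednik in
theorem proposition1p4 (n : ℕ) (hn : 0 < n) (m : ℤ) (hmn : IsCoprime m (n : ℤ))
    (c : ℂ) (hc : c = (m : ℂ) / (n : ℂ))
    (L : Type*) [AddCommGroup L] [Module ℂ L] [Module (Alg n c) L] [IsScalarTower ℂ (Alg n c) L]
    [FiniteDimensional ℂ L] [IsSimpleModule (Alg n c) L]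
    (F : Filtr n c L) :
    -- the maps `α_N : 𝔥 → 𝐇_c` are `S_n`-equivariant and of filtration degree `wt N`
    (∀ (N : ℤ) (σ : Equiv.Perm (Fin n)) (v : refl n),
      alpha n c N (perm σ v) * S c σ = S c σ * alpha n c N v) ∧
    (∀ (N : ℤ) (v : refl n), alpha n c N v ∈ G n c (wt N)) ∧
    ∃ d : ℤ → Module.End ℂ (H F),
      -- `d N` is the one map on associated graded spaces induced by contraction with `α_N`
      (∀ N : ℤ, IsInduced F (wt N) (contract (alpha n c N)) (d N)) ∧
      (∀ (N : ℤ) (e : Module.End ℂ (H F)),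
        IsInduced F (wt N) (contract (alpha n c N)) e → e = d N) ∧
      -- differentials, mutually anticommuting
      (∀ N : ℤ, d N * d N = 0) ∧
      (∀ M N : ℤ, d M * d N + d N * d M = 0) ∧
      -- behaviour with respect to the triple grading
      (∀ N a q f : ℤ, ∀ ψ ∈ piece F m a q f,
        d N ψ ∈ piece F m (a - 2) (q + 2 * N) (f + wt N)) ∧
      -- the Fourier transform
      Function.Bijective (fourierMod n c L) ∧
      (∀ (h : Alg n c) (p : L), fourierMod n c L (h • p) = fourier n c h • fourierMod n c L p) ∧
      (F.Sl2Stable → ∃ Phi : H F ≃ₗ[ℂ] H F,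
        IsInduced F 0 (fun φ => (fourierMod n c L).comp φ) Phi.toLinearMap ∧
        ∀ N : ℤ, ∃ ε : ℂ, (ε = 1 ∨ ε = -1) ∧
          ∀ ψ : H F, Phi (d N ψ) = ε • d (-N) (Phi ψ)) := by
  refine ⟨alpha_perm, fun N v => lin_pow_le_G _ (alpha_mem_lin_pow N v), diff F, isInduced_diff,
    fun N e he => (isInduced_diff N).unique he, diff_sq, diff_anticomm,
    fun N a q f ψ hψ => diff_mem_piece N m a q f hψ, bijective_fourierMod, fourierMod_smul,
    fun hF => ?_⟩
  -- The inverse of `Φ` on `L` is also filtered and equivariant, so it induces the inverse of `Φ` on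
  -- `H`.
  obtain ⟨U, hTU, hUT⟩ := isUnit_iff_exists.1 (isUnit_fourierMod (n := n) (c := c) (L := L))
  have hT := fourierMod_mem_shift hF
  have hU := mem_shift_zero_of_mul_eq_one hT hUT
  have hUS : ∀ σ, U * act n c L (S c σ) = act n c L (S c σ) * U := fun σ => by
    have h := congrArg (fun A => U * A * U) (fourierMod_mul_S (n := n) (c := c) (L := L) σ)
    simp only [mul_assoc, hTU, mul_one] at h
    simp only [← mul_assoc, hUT, one_mul] at h
    exact h.symm
  exact ⟨LinearEquiv.ofLinearMap (Hmap F _ hT fourierMod_mul_S) (Hmap F U hU hUS)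
    (Hmap_mul_eq_one _ _ _ _ hTU) (Hmap_mul_eq_one _ _ _ _ hUT),
    isInduced_Hmap hT fourierMod_mul_S, Hmap_diff hT fourierMod_mul_S fourierMod_mul_act⟩
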